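/- Let $k$ be a field, let $n\ge 0$, let $R=k[x_0,x_1,\dots,x_n]$ be the standard graded polynomial ring and let $S_1=k[x_1,\dots,x_n]\subset R$. Regard $k$ as a graded module over $R$ and over $S_1$, concentrated in degree $0$ and annihilated by the variables. Let $M$ be a ($\mathbb Z$-)graded $R$-module, which is also regarded as a graded $S_1$-module. For $A\in\{R,S_1\}$ write $\operatorname{Tor}_i^{A}(M,k)_t$ for the degree-$t$ component of the graded module $\operatorname{Tor}_i^{A}(M,k)$, that is, the $i$-th homology of the degree-$t$ part of $M\otimes_A F_\bullet$ for a graded free resolution $F_\bullet\to k$ over $A$ (any choice of resolutions may be made); put $\operatorname{Tor}_{-1}^{A}(M,k)=0$. Then for all integers $i\ge 0$ and $j$ there are $k$-linear maps fitting into a long exact sequence $$\cdots\to\operatorname{Tor}_i^{S_1}(M,k)_{i+j}\to\operatorname{Tor}_i^{R}(M,k)_{i+j}\to\operatorname{Tor}_{i-1}^{S_1}(M,k)_{i+j-1}\xrightarrow{\ \delta\ }\operatorname{Tor}_{i-1}^{S_1}(M,k)_{i+j}\to\operatorname{Tor}_{i-1}^{R}(M,k)_{i+j}\to\cdots\to\operatorname{Tor}_0^{S_1}(M,k)_{i+j}\to\operatorname{Tor}_0^{R}(M,k)_{i+j}\to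 0,$$ whose connecting homomorphism $\delta$ is multiplication by $x_0$, i.e. the map induced by the $S_1$-linear map $M\to M$, $m\mapsto x_0m$. -/

import Mathlib

open scoped TensorProduct

universe u v w

/-- `ℳ` is a `ℤ`-grading of the module `M` over the `ℕ`-graded `k`-algebra `(A, 𝒜)`:
`M = ⨁ e, ℳ e` and `𝒜 c • ℳ e ⊆ ℳ (c + e)`. -/
structure IsGradedModule {k : Type*} {A : Type*} {M : Type*} [Field k] [CommRing A] [Algebra k A]
    [AddCommGroup M] [Module k M] [Module A M]
    (𝒜 : ℕ → Submodule k A) (ℳ : ℤ → Submodule k M) : Prop where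
  isInternal : DirectSum.IsInternal ℳ
  smul_mem : ∀ (c : ℕ) (e : ℤ) (a : A) (m : M), a ∈ 𝒜 c → m ∈ ℳ e → a • m ∈ ℳ (c + e)

/-- A graded free resolution `⋯ → X 1 → X 0 → k → 0` of `k` over the graded `k`-algebra `(A, 𝒜)`,
where `k` is the `A`-module concentrated in degree `0` on which `A` acts through the augmentation
`aug : A → k`. All modules `X i` are graded and free on homogeneous bases, and all maps are
`A`-linear and homogeneous of degree `0`. (An `A`-linear map to `k` is the same thing
as a map semilinear along `aug`.) -/
structure GradedFreeResolution {k : Type u} {A : Type v} [Field k] [CommRing A] [Algebra k A]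
    (𝒜 : ℕ → Submodule k A) (aug : A →ₐ[k] k) where
  X : ℕ → Type w
  [addCommGroup : ∀ i, AddCommGroup (X i)]
  [moduleBase : ∀ i, Module k (X i)]
  [module : ∀ i, Module A (X i)]
  [isScalarTower : ∀ i, IsScalarTower k A (X i)]
  gr : ∀ i, ℤ → Submodule k (X i)
  graded : ∀ i, IsGradedModule 𝒜 (gr i)
  free : ∀ i, ∃ (ι : Type w) (b : Module.Basis ι A (X i)), ∀ j, ∃ e, b j ∈ gr i e
  d : ∀ i, X (i + 1) →ₗ[A] X i
  d_mem : ∀ i e x, x ∈ gr (i + 1) e → d i x ∈ gr i e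
  ε : X 0 →ₛₗ[(aug : A →+* k)] k
  ε_eq_zero : ∀ e x, e ≠ 0 → x ∈ gr 0 e → ε x = 0
  ε_surjective : Function.Surjective ε
  exact_zero : Function.Exact (d 0) ε
  exact_succ : ∀ i, Function.Exact (d (i + 1)) (d i)

attribute [instance] GradedFreeResolution.addCommGroup GradedFreeResolution.moduleBase
  GradedFreeResolution.module GradedFreeResolution.isScalarTower

section Tor

variable {k : Type*} {A : Type*} [Field k] [CommRing A] [Algebra k A]
variable {M : Type*} [AddCommGroup M] [Module k M] [Module A M] [IsScalarTower k A M]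

/-- The degree `t` part of `M ⊗[A] N`, for graded modules `M` and `N`: it is spanned by the tensors
`m ⊗ x` of homogeneous elements with `deg m + deg x = t`. -/
def tensorDegree (A : Type*) [CommRing A] [Algebra k A] [Module A M] [IsScalarTower k A M]
    {N : Type*} [AddCommGroup N] [Module k N] [Module A N]
    (ℳ : ℤ → Submodule k M) (𝒩 : ℤ → Submodule k N) (t : ℤ) : Submodule k (M ⊗[A] N) :=
  Submodule.span k {z | ∃ a b : ℤ, a + b = t ∧ ∃ m ∈ ℳ a, ∃ x ∈ 𝒩 b, z = m ⊗ₜ[A] x}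

variable {𝒜 : ℕ → Submodule k A} {aug : A →ₐ[k] k}

namespace GradedFreeResolution

variable (P : GradedFreeResolution 𝒜 aug) (ℳ : ℤ → Submodule k M)

/-- The differential of the complex `M ⊗[A] X`, as a `k`-linear map. -/
noncomputable def tensorD (M : Type*) [AddCommGroup M] [Module k M] [Module A M]
    [IsScalarTower k A M] (i : ℕ) : M ⊗[A] P.X (i + 1) →ₗ[k] M ⊗[A] P.X i :=
  ((P.d i).lTensor M).restrictScalars k

/-- The cycles of `M ⊗[A] X` in homological degree `i` and internal degree `t`. -/
noncomputable def cycles : (i : ℕ) → (t : ℤ) → Submodule k (M ⊗[A] P.X i)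
  | 0, t => tensorDegree A ℳ (P.gr 0) t
  | i + 1, t => tensorDegree A ℳ (P.gr (i + 1)) t ⊓ LinearMap.ker (P.tensorD M i)

/-- The boundaries of `M ⊗[A] X` in homological degree `i` and internal degree `t`. -/
noncomputable def boundaries (i : ℕ) (t : ℤ) : Submodule k (M ⊗[A] P.X i) :=
  (tensorDegree A ℳ (P.gr (i + 1)) t).map (P.tensorD M i)

/-- The graded component `Tor_i^A(M, k)_t`: the homology in homological degree `i` and internal
degree `t` of `M ⊗[A] X`, where `X` is a graded free resolution of `k` over `A`. -/
abbrev Tor (i : ℕ) (t : ℤ) : Type _ :=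
  P.cycles ℳ i t ⧸ (P.boundaries ℳ i t).submoduleOf (P.cycles ℳ i t)

variable {ℳ}

theorem rTensor_mem_tensorDegree {N : Type*} [AddCommGroup N] [Module k N] [Module A N]
    {𝒩 : ℤ → Submodule k N} {φ : M →ₗ[A] M} {c : ℤ}
    (hφ : ∀ e, ∀ m ∈ ℳ e, φ m ∈ ℳ (e + c)) {t : ℤ} {z : M ⊗[A] N}
    (hz : z ∈ tensorDegree A ℳ 𝒩 t) : φ.rTensor N z ∈ tensorDegree A ℳ 𝒩 (t + c) := by
  unfold tensorDegree at hz
  induction hz using Submodule.span_induction with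
  | mem z hz =>
    obtain ⟨a, b, hab, m, hm, x, hx, rfl⟩ := hz
    exact Submodule.subset_span ⟨a + c, b, by omega, φ m, hφ a m hm, x, hx, by simp⟩
  | zero => simp
  | add x y _ _ hx hy => rw [map_add]; exact add_mem hx hy
  | smul r x _ hx =>
    have : φ.rTensor N (r • x) = r • φ.rTensor N x :=
      ((φ.rTensor N).restrictScalars k).map_smul r x
    rw [this]; exact Submodule.smul_mem _ _ hx

theorem tensorD_rTensor (φ : M →ₗ[A] M) (i : ℕ) (z : M ⊗[A] P.X (i + 1)) :
    P.tensorD M i (φ.rTensor _ z) = φ.rTensor _ (P.tensorD M i z) := by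
  change (P.d i).lTensor M (φ.rTensor _ z) = φ.rTensor _ ((P.d i).lTensor M z)
  rw [← LinearMap.comp_apply, ← LinearMap.comp_apply, LinearMap.lTensor_comp_rTensor,
    LinearMap.rTensor_comp_lTensor]

theorem rTensor_mem_cycles {φ : M →ₗ[A] M} {c : ℤ}
    (hφ : ∀ e, ∀ m ∈ ℳ e, φ m ∈ ℳ (e + c)) {i : ℕ} {t : ℤ} {z : M ⊗[A] P.X i}
    (hz : z ∈ P.cycles ℳ i t) : φ.rTensor _ z ∈ P.cycles ℳ i (t + c) := by
  cases i with
  | zero => exact rTensor_mem_tensorDegree hφ hz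
  | succ i =>
    refine ⟨rTensor_mem_tensorDegree hφ hz.1, ?_⟩
    have h : P.tensorD M i z = 0 := hz.2
    rw [SetLike.mem_coe, LinearMap.mem_ker, tensorD_rTensor, h, map_zero]

theorem rTensor_mem_boundaries {φ : M →ₗ[A] M} {c : ℤ}
    (hφ : ∀ e, ∀ m ∈ ℳ e, φ m ∈ ℳ (e + c)) {i : ℕ} {t : ℤ} {z : M ⊗[A] P.X i}
    (hz : z ∈ P.boundaries ℳ i t) : φ.rTensor _ z ∈ P.boundaries ℳ i (t + c) := by
  obtain ⟨y, hy, rfl⟩ := hz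
  exact ⟨φ.rTensor _ y, rTensor_mem_tensorDegree hφ hy, P.tensorD_rTensor φ i y⟩

/-- The map `Tor_i^A(M, k)_t → Tor_i^A(M, k)_{t + c}` induced by an `A`-linear endomorphism `φ`
of `M` that is homogeneous of degree `c`. -/
noncomputable def torMap (φ : M →ₗ[A] M) (c : ℤ) (hφ : ∀ e, ∀ m ∈ ℳ e, φ m ∈ ℳ (e + c))
    (i : ℕ) (t : ℤ) : P.Tor ℳ i t →ₗ[k] P.Tor ℳ i (t + c) :=
  Submodule.mapQ _ _
    (((φ.rTensor (P.X i)).restrictScalars k).restrict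
      (p := P.cycles ℳ i t) (q := P.cycles ℳ i (t + c)) fun _ hz => P.rTensor_mem_cycles hφ hz)
    fun _ hz => P.rTensor_mem_boundaries hφ hz

end GradedFreeResolution

end Tor

section PolynomialRings

variable (k : Type u) [Field k] (n : ℕ)

/-- The polynomial ring `R = k[x₀, …, xₙ]`. -/
abbrev PolyR : Type u := MvPolynomial (Fin (n + 1)) k

/-- The standard grading of `R`. -/
abbrev gradingR : ℕ → Submodule k (PolyR k n) := MvPolynomial.homogeneousSubmodule (Fin (n + 1)) k

/-- The augmentation `R → k`, `xᵢ ↦ 0`. -/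
noncomputable def augR : PolyR k n →ₐ[k] k := MvPolynomial.aeval fun _ => 0

/-- The subring `S₁ = k[x₁, …, xₙ]` of `R`. -/
noncomputable abbrev PolyS : Subalgebra k (PolyR k n) :=
  MvPolynomial.supported k (Set.range (Fin.succ : Fin n → Fin (n + 1)))

/-- The standard grading of `S₁`. -/
noncomputable def gradingS (t : ℕ) : Submodule k (PolyS k n) :=
  (gradingR k n t).comap (PolyS k n).val.toLinearMap

/-- The augmentation `S₁ → k`, `xᵢ ↦ 0`. -/
noncomputable def augS : PolyS k n →ₐ[k] k := (augR k n).comp (PolyS k n).val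

variable {k n}
variable {M : Type v} [AddCommGroup M] [Module k M] [Module (PolyR k n) M]
  {ℳ : ℤ → Submodule k M}

/-- Multiplication by `x₀` on an `R`-module, as an `S₁`-linear map. -/
noncomputable def mulX0 (k : Type u) [Field k] (n : ℕ) (M : Type v) [AddCommGroup M]
    [Module (PolyR k n) M] : M →ₗ[PolyS k n] M where
  toFun m := (MvPolynomial.X 0 : PolyR k n) • m
  map_add' := smul_add _
  map_smul' s m := by
    change (MvPolynomial.X 0 : PolyR k n) • (s : PolyR k n) • m
      = (s : PolyR k n) • (MvPolynomial.X 0 : PolyR k n) • m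
    rw [smul_smul, smul_smul, mul_comm]

theorem mulX0_mem (hM : IsGradedModule (gradingR k n) ℳ) (e : ℤ) (m : M) (hm : m ∈ ℳ e) :
    mulX0 k n M m ∈ ℳ (e + 1) := by
  have h := hM.smul_mem 1 e (MvPolynomial.X 0) m (MvPolynomial.isHomogeneous_X k 0) hm
  rw [Nat.cast_one, add_comm] at h
  exact h

/-- Multiplication by `x₀`, `Tor_i^{S₁}(M, k)_t → Tor_i^{S₁}(M, k)_{t + 1}`. -/
noncomputable def torMulX0 [IsScalarTower k (PolyR k n) M]
    (P : GradedFreeResolution (gradingS k n) (augS k n))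
    (hM : IsGradedModule (gradingR k n) ℳ) (i : ℕ) (t : ℤ) :
    P.Tor ℳ i t →ₗ[k] P.Tor ℳ i (t + 1) :=
  P.torMap (mulX0 k n M) 1 (mulX0_mem hM) i t

end PolynomialRings

namespace GradedFreeResolution

section Existence

variable {k A : Type u} [Field k] [CommRing A] [Algebra k A] (𝒜 : ℕ → Submodule k A)

theorem mem_iSup_inf_ker {X Y : Type*} [AddCommGroup X] [Module k X] [AddCommGroup Y] [Module k Y]
    {𝒳 : ℤ → Submodule k X} {𝒴 : ℤ → Submodule k Y} (h𝒳 : iSup 𝒳 = ⊤) (h𝒴 : iSupIndep 𝒴)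
    (φ : X →+ Y) (hφ : ∀ e, ∀ x ∈ 𝒳 e, φ x ∈ 𝒴 e) {x : X} (hx : φ x = 0) :
    x ∈ AddSubmonoid.closure {y | φ y = 0 ∧ ∃ e, y ∈ 𝒳 e} := by
  classical
  have hx' : x ∈ iSup 𝒳 := h𝒳 ▸ Submodule.mem_top
  obtain ⟨f, hf, rfl⟩ := (Submodule.mem_iSup_iff_exists_finsupp _ _).1 hx'
  have h0 : ∀ e ∈ f.support, φ (f e) = 0 := by
    apply (iSupIndep_iff_finsetSum_eq_zero_imp_eq_zero 𝒴).1 h𝒴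
    · intro e _
      exact hφ e _ (hf e)
    · rw [← map_sum]
      exact hx
  exact AddSubmonoid.sum_mem _ fun e he => AddSubmonoid.subset_closure ⟨h0 e he, e, hf e⟩

theorem iSupIndep_degree_zero {Y : Type*} [AddCommGroup Y] [Module k Y] :
    iSupIndep fun e : ℤ => if e = 0 then (⊤ : Submodule k Y) else ⊥ := by
  intro e
  rw [Submodule.disjoint_def]
  intro x hx hx'
  by_cases he : e = 0
  · have : (⨆ e', ⨆ (_ : e' ≠ e), if e' = 0 then (⊤ : Submodule k Y) else ⊥) ≤ ⊥ := by
      refine iSup₂_le fun e' he' => ?_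
      rw [if_neg (he ▸ he')]
    exact this hx'
  · simpa only [if_neg he, Submodule.mem_bot] using hx

variable [GradedAlgebra 𝒜]

/-- The grading of the free module on a basis with prescribed degrees. -/
noncomputable def freeGr {ι : Type u} (deg : ι → ℤ) (e : ℤ) : Submodule k (ι →₀ A) :=
  ⨅ (j : ι) (m : ℕ) (_ : (m : ℤ) + deg j ≠ e),
    LinearMap.ker ((GradedAlgebra.proj 𝒜 m) ∘ₗ (Finsupp.lapply (R := k) j))

variable {𝒜} in
theorem mem_freeGr {ι : Type u} {deg : ι → ℤ} {e : ℤ} {x : ι →₀ A} :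
    x ∈ freeGr 𝒜 deg e ↔
      ∀ j (m : ℕ), (m : ℤ) + deg j ≠ e → (DirectSum.decompose 𝒜 (x j) m : A) = 0 := by
  simp [freeGr, Submodule.mem_iInf]

theorem single_mem_freeGr {ι : Type u} (deg : ι → ℤ) (j : ι) {m : ℕ} {a : A} (ha : a ∈ 𝒜 m) :
    Finsupp.single j a ∈ freeGr 𝒜 deg (m + deg j) := by
  classical
  rw [mem_freeGr]
  intro i m' h
  rw [Finsupp.single_apply]
  split_ifs with hij
  · subst hij
    exact DirectSum.decompose_of_mem_ne 𝒜 ha fun hm => h (by rw [hm])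
  · simp

theorem iSup_freeGr {ι : Type u} (deg : ι → ℤ) : iSup (freeGr 𝒜 deg) = ⊤ := by
  classical
  rw [eq_top_iff]
  rintro x -
  induction x using Finsupp.induction_linear with
  | zero => exact zero_mem _
  | add x y hx hy => exact add_mem hx hy
  | single j a =>
    rw [← DirectSum.sum_support_decompose 𝒜 a, Finsupp.single_finsetSum]
    exact Submodule.sum_mem _ fun m _ => Submodule.mem_iSup_of_mem _
      (single_mem_freeGr 𝒜 deg j (SetLike.coe_mem (DirectSum.decompose 𝒜 a m)))

theorem isGradedModule_freeGr {ι : Type u} (deg : ι → ℤ) :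
    IsGradedModule 𝒜 (freeGr 𝒜 deg) := by
  classical
  refine ⟨?_, ?_⟩
  · rw [DirectSum.isInternal_submodule_iff_iSupIndep_and_iSup_eq_top]
    refine ⟨fun e => ?_, iSup_freeGr 𝒜 deg⟩
    rw [Submodule.disjoint_def]
    intro x hx hx'
    ext j
    rw [Finsupp.zero_apply, ← DirectSum.sum_support_decompose 𝒜 (x j)]
    refine Finset.sum_eq_zero fun m _ => ?_
    by_cases h : (m : ℤ) + deg j = e
    · have : (⨆ e', ⨆ (_ : e' ≠ e), freeGr 𝒜 deg e') ≤
          LinearMap.ker ((GradedAlgebra.proj 𝒜 m) ∘ₗ (Finsupp.lapply (R := k) j)) := by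
        refine iSup₂_le fun e' he' y hy => ?_
        exact mem_freeGr.1 hy j m (by rw [h]; exact he'.symm)
      exact this hx'
    · exact mem_freeGr.1 hx j m h
  · intro c e a x ha hx
    rw [mem_freeGr] at hx ⊢
    intro j m h
    rw [Finsupp.smul_apply, smul_eq_mul]
    by_cases hc : c ≤ m
    · rw [DirectSum.coe_decompose_mul_of_left_mem_of_le 𝒜 ha hc, hx j (m - c), mul_zero]
      intro h'
      apply h
      rw [Nat.cast_sub hc] at h'
      linarith
    · exact DirectSum.coe_decompose_mul_of_left_mem_of_not_le 𝒜 ha hc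

theorem exists_of_mem_freeGr {ι : Type u} {deg : ι → ℤ} {e : ℤ} {x : ι →₀ A}
    (hx : x ∈ freeGr 𝒜 deg e) (j : ι) : x j = 0 ∨ ∃ m : ℕ, (m : ℤ) + deg j = e ∧ x j ∈ 𝒜 m := by
  classical
  rw [mem_freeGr] at hx
  by_cases h : ∃ m : ℕ, (m : ℤ) + deg j = e
  · obtain ⟨m, hm⟩ := h
    refine Or.inr ⟨m, hm, ?_⟩
    rw [← DirectSum.sum_support_decompose 𝒜 (x j)]
    refine Submodule.sum_mem _ fun m' _ => ?_
    by_cases hm' : m' = m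
    · subst hm'
      exact SetLike.coe_mem _
    · rw [hx j m' fun h => hm' (by omega)]
      exact zero_mem _
  · left
    rw [← DirectSum.sum_support_decompose 𝒜 (x j)]
    exact Finset.sum_eq_zero fun m _ => hx j m fun h' => h ⟨m, h'⟩

/-- A graded free module with a submodule generated by homogeneous elements. -/
structure Stage where
  ι : Type u
  deg : ι → ℤ
  K : Submodule A (ι →₀ A)
  hK : K ≤ Submodule.span A {y | y ∈ K ∧ ∃ e, y ∈ freeGr 𝒜 deg e}

namespace Stage

variable {𝒜} (s : Stage 𝒜)

/-- The homogeneous elements of the submodule. -/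
def Gen : Type u := {p : ℤ × (s.ι →₀ A) // p.2 ∈ s.K ∧ p.2 ∈ freeGr 𝒜 s.deg p.1}

/-- The map from the free module on the homogeneous elements of the submodule. -/
noncomputable def map : (s.Gen →₀ A) →ₗ[A] (s.ι →₀ A) :=
  Finsupp.linearCombination A fun p : s.Gen => p.1.2

theorem range_map : LinearMap.range s.map = s.K := by
  rw [map, Finsupp.range_linearCombination]
  refine le_antisymm (Submodule.span_le.2 ?_) (s.hK.trans (Submodule.span_mono ?_))
  · rintro _ ⟨p, rfl⟩
    exact p.2.1
  · rintro y ⟨hy, e, he⟩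
    exact ⟨⟨(e, y), hy, he⟩, rfl⟩

theorem mem_K_iff (x : s.ι →₀ A) : x ∈ s.K ↔ x ∈ Set.range s.map := by
  rw [← s.range_map]
  rfl

theorem map_mem (e : ℤ) (x : s.Gen →₀ A) (hx : x ∈ freeGr 𝒜 (fun p : s.Gen => p.1.1) e) :
    s.map x ∈ freeGr 𝒜 s.deg e := by
  rw [map, Finsupp.linearCombination_apply]
  refine Submodule.sum_mem _ fun p _ => ?_
  rcases exists_of_mem_freeGr 𝒜 hx p with h | ⟨m, hm, h⟩
  · simp [h]
  · rw [← hm]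
    exact (isGradedModule_freeGr 𝒜 s.deg).smul_mem _ _ _ _ h p.2.2

/-- The next stage: the kernel of the map above. -/
noncomputable def next : Stage 𝒜 where
  ι := s.Gen
  deg p := p.1.1
  K := LinearMap.ker s.map
  hK x hx := by
    have h := mem_iSup_inf_ker (iSup_freeGr 𝒜 (fun p : s.Gen => p.1.1))
      (isGradedModule_freeGr 𝒜 s.deg).isInternal.submodule_iSupIndep
      s.map.toAddMonoidHom s.map_mem hx
    exact AddSubmonoid.closure_le.2 (Submodule.subset_span (R := A)) h

end Stage

/-- Graded free resolutions of `k` exist. -/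
theorem nonempty (aug : A →ₐ[k] k) (haug : ∀ m ≠ 0, ∀ a ∈ 𝒜 m, aug a = 0) :
    Nonempty (GradedFreeResolution.{u, u, u} 𝒜 aug) := by
  classical
  let ε : (PUnit.{u + 1} →₀ A) →ₛₗ[(aug : A →+* k)] k :=
    { toFun := fun x => aug (x PUnit.unit)
      map_add' := fun x y => by simp
      map_smul' := fun a x => by simp }
  let 𝒴 : ℤ → Submodule k k := fun e => if e = 0 then ⊤ else ⊥
  have hε : ∀ e, ∀ x ∈ freeGr 𝒜 (fun _ : PUnit.{u + 1} => (0 : ℤ)) e, e ≠ 0 → ε x = 0 := by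
    intro e x hx he
    rcases exists_of_mem_freeGr 𝒜 hx PUnit.unit with h | ⟨m, hm, h⟩
    · change aug _ = 0
      rw [h, map_zero]
    · exact haug m (by rintro rfl; exact he (by simpa using hm.symm)) _ h
  have h𝒴 : iSupIndep 𝒴 := iSupIndep_degree_zero
  let s0 : Stage 𝒜 :=
    { ι := PUnit.{u + 1}
      deg := fun _ => 0
      K := LinearMap.ker ε
      hK := fun x hx => by
        have h := mem_iSup_inf_ker (iSup_freeGr 𝒜 (fun _ : PUnit.{u + 1} => (0 : ℤ))) h𝒴
          ε.toAddMonoidHom (fun e x hx => by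
            by_cases he : e = 0
            · simp only [𝒴, if_pos he]
              exact Submodule.mem_top
            · have h0 : ε.toAddMonoidHom x = 0 := hε e x hx he
              rw [h0]
              exact zero_mem _) hx
        exact AddSubmonoid.closure_le.2 (Submodule.subset_span (R := A)) h }
  let S : ℕ → Stage 𝒜 := fun i => Nat.rec s0 (fun _ s => s.next) i
  exact ⟨
    { X := fun i => (S i).ι →₀ A
      gr := fun i => freeGr 𝒜 (S i).deg
      graded := fun i => isGradedModule_freeGr 𝒜 _
      free := fun i => ⟨(S i).ι, Finsupp.basisSingleOne, fun j =>
        ⟨_, by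
          rw [Finsupp.coe_basisSingleOne]
          exact single_mem_freeGr 𝒜 _ j SetLike.GradedOne.one_mem⟩⟩
      d := fun i => (S i).map
      d_mem := fun i => (S i).map_mem
      ε := ε
      ε_eq_zero := fun e x he hx => hε e x hx he
      ε_surjective := fun c => ⟨Finsupp.single PUnit.unit (algebraMap k A c), by
        change aug _ = c
        simp⟩
      exact_zero := fun x => s0.mem_K_iff x
      exact_succ := fun i x => (S (i + 1)).mem_K_iff x }⟩

end Existence

section Polynomial

attribute [local instance] MvPolynomial.gradedAlgebra

/-- Graded free resolutions of `k` over `R` exist. -/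
theorem nonempty_R (k : Type u) [Field k] (n : ℕ) :
    Nonempty (GradedFreeResolution.{u, u, u} (gradingR k n) (augR k n)) := by
  refine nonempty _ _ fun m hm a ha => ?_
  have h : MvPolynomial.coeff 0 a = 0 := by
    by_contra h
    exact hm (by simpa [Finsupp.weight] using (ha h).symm)
  rw [augR, ← MvPolynomial.constantCoeff_eq] at *
  simpa using h

/-- Graded free resolutions of `k` over `S₁` exist. -/
theorem nonempty_S (k : Type u) [Field k] (n : ℕ) :
    Nonempty (GradedFreeResolution.{u, u, u} (gradingS k n) (augS k n)) := by
  classical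
  have hmem : ∀ (m : ℕ) (p : PolyS k n),
      MvPolynomial.homogeneousComponent m (p : PolyR k n) ∈ PolyS k n := by
    intro m p
    rw [MvPolynomial.mem_supported]
    refine subset_trans ?_ (MvPolynomial.mem_supported.1 p.2)
    intro i hi
    rw [Finset.mem_coe, MvPolynomial.mem_vars_iff_mem_support] at hi ⊢
    obtain ⟨d, hd, hi⟩ := hi
    rw [MvPolynomial.support_homogeneousComponent, Finset.mem_filter] at hd
    exact ⟨d, hd.1, hi⟩
  have : SetLike.GradedMonoid (gradingS k n) :=
    { one_mem := (SetLike.GradedOne.one_mem : (1 : PolyR k n) ∈ gradingR k n 0)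
      mul_mem := fun i j a b ha hb =>
        (SetLike.GradedMul.mul_mem ha hb : (a : PolyR k n) * b ∈ gradingR k n (i + j)) }
  have hint : DirectSum.IsInternal (gradingS k n) := by
    rw [DirectSum.isInternal_submodule_iff_iSupIndep_and_iSup_eq_top]
    constructor
    · intro m
      rw [Submodule.disjoint_def]
      intro x hx hx'
      have h1 : (⨆ m', ⨆ (_ : m' ≠ m), gradingS k n m') ≤
          LinearMap.ker ((MvPolynomial.homogeneousComponent m) ∘ₗ (PolyS k n).val.toLinearMap) := by
        refine iSup₂_le fun m' hm' y hy => ?_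
        exact (MvPolynomial.homogeneousComponent_of_mem hy).trans (if_neg hm'.symm)
      have h2 : MvPolynomial.homogeneousComponent m (x : PolyR k n) = 0 := h1 hx'
      have h3 : MvPolynomial.homogeneousComponent m (x : PolyR k n) = x :=
        MvPolynomial.homogeneousComponent_eq_self hx
      exact Subtype.ext (h3.symm.trans h2)
    · rw [eq_top_iff]
      rintro x -
      have : x = ∑ m ∈ Finset.range ((x : PolyR k n).totalDegree + 1),
          (⟨MvPolynomial.homogeneousComponent m (x : PolyR k n), hmem m x⟩ : PolyS k n) := by
        apply Subtype.ext
        rw [AddSubmonoidClass.coe_finsetSum]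
        exact (MvPolynomial.sum_homogeneousComponent _).symm
      rw [this]
      exact Submodule.sum_mem _ fun m _ => Submodule.mem_iSup_of_mem m
        (MvPolynomial.homogeneousComponent_mem m (x : PolyR k n))
  let : DirectSum.Decomposition (gradingS k n) := hint.chooseDecomposition
  let : GradedAlgebra (gradingS k n) := { }
  refine nonempty _ _ fun m hm a ha => ?_
  have h : MvPolynomial.coeff 0 (a : PolyR k n) = 0 := by
    by_contra h
    have ha' : (a : PolyR k n).IsHomogeneous m := ha
    exact hm (by simpa [Finsupp.weight] using (ha' h).symm)
  change augR k n a = 0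
  rw [augR, ← MvPolynomial.constantCoeff_eq] at *
  simpa using h

end Polynomial

end GradedFreeResolution

/-! Let `Q` be a graded free resolution of `k` over `R`. Since `R` is free over `S₁` on the powers
of `x₀`, `Q` is also a graded free resolution over `S₁` (`restrictS`), so one complex of modules
computes both kinds of `Tor`. Passing from `M ⊗[S₁] Q` to `M ⊗[R] Q` imposes only the relation that
`x₀` may cross the tensor sign, so with `D = x₀ ⊗ 1 - 1 ⊗ x₀` there is a short exact sequence of
complexes `0 → M ⊗[S₁] Q → M ⊗[S₁] Q → M ⊗[R] Q → 0` whose first map `D` raises degree by one.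
Exactness in the middle is `exists_X0Commutator_eq`, injectivity of `D` is `X0Commutator_injective`,
and `exists_exact_tor` produces the long exact sequence.

The map that `D` induces on homology is multiplication by `x₀` on `M`: the other term `1 ⊗ x₀` comes
from a chain map lifting `x₀ = 0` on `k`, hence is nullhomotopic (`lTensor_mulX0_mem_boundaries`).
Finally `exists_torEquiv` replaces the restricted resolution by an arbitrary one over `S₁`,
compatibly with `x₀`. -/

/-! ### Homogeneous lifts from free modules, and the grading of a tensor product. -/

section GradedLifting

variable {k A : Type*} [Field k] [CommRing A] [Algebra k A] {𝒜 : ℕ → Submodule k A}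

/-- Split `x` into homogeneous pieces: the images of the pieces outside degree `e` lie outside
degree `e + c`, so by independence they sum to zero and the piece of degree `e` has the same image.
This turns arbitrary preimages into homogeneous ones. -/
theorem exists_mem_map_eq_of_map_mem {X Y : Type*} [AddCommGroup X] [Module k X] [AddCommGroup Y]
    [Module k Y] {𝒳 : ℤ → Submodule k X} {𝒴 : ℤ → Submodule k Y} (h𝒳 : iSup 𝒳 = ⊤)
    (h𝒴 : iSupIndep 𝒴) (φ : X →+ Y) {c : ℤ} (hφ : ∀ e, ∀ x ∈ 𝒳 e, φ x ∈ 𝒴 (e + c)) {x : X} {e : ℤ}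
    (hx : φ x ∈ 𝒴 (e + c)) : ∃ x' ∈ 𝒳 e, φ x' = φ x := by
  classical
  have hx' : x ∈ iSup 𝒳 := h𝒳 ▸ Submodule.mem_top
  obtain ⟨f, hf, rfl⟩ := (Submodule.mem_iSup_iff_exists_finsupp _ _).1 hx'
  refine ⟨f e, hf e, ?_⟩
  have hsum : φ (f.sum fun _ x => x) - φ (f e) = ∑ i ∈ f.support.erase e, φ (f i) := by
    by_cases he : e ∈ f.support
    · rw [Finsupp.sum, ← Finset.add_sum_erase _ _ he, map_add, add_sub_cancel_left, map_sum]
    · rw [Finset.erase_eq_of_notMem he, Finsupp.notMem_support_iff.1 he, map_zero, sub_zero,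
        Finsupp.sum, map_sum]
  have h1 : φ (f.sum fun _ x => x) - φ (f e) ∈ ⨆ i, ⨆ (_ : i ≠ e + c), 𝒴 i := by
    rw [hsum]
    refine Submodule.sum_mem _ fun i hi => ?_
    refine Submodule.mem_iSup_of_mem (i + c) (Submodule.mem_iSup_of_mem ?_ (hφ i _ (hf i)))
    have := Finset.ne_of_mem_erase hi
    omega
  have h2 := Submodule.disjoint_def.1 (h𝒴 (e + c)) _ (sub_mem hx (hφ e _ (hf e))) h1
  exact (sub_eq_zero.1 h2).symm

variable {N : Type*} [AddCommGroup N] [Module k N] [Module A N]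
  {𝒩 : ℤ → Submodule k N}

theorem mem_span_smul_basis [IsScalarTower k A N] (h𝒜 : iSup 𝒜 = ⊤) (hN : IsGradedModule 𝒜 𝒩)
    {ι : Type*} (b : Module.Basis ι A N) {deg : ι → ℤ} (hb : ∀ j, b j ∈ 𝒩 (deg j)) {e : ℤ} {x : N}
    (hx : x ∈ 𝒩 e) :
    x ∈ Submodule.span k {y | ∃ (c : ℕ) (j : ι), (c : ℤ) + deg j = e ∧ ∃ a ∈ 𝒜 c, y = a • b j} := by
  let T : ℤ → Submodule k N := fun e =>
    Submodule.span k {y | ∃ (c : ℕ) (j : ι), (c : ℤ) + deg j = e ∧ ∃ a ∈ 𝒜 c, y = a • b j}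
  have hT : iSup T = ⊤ := by
    rw [eq_top_iff]
    rintro x -
    rw [← b.linearCombination_repr x, Finsupp.linearCombination_apply]
    refine Submodule.sum_mem _ fun j _ => ?_
    change b.repr x j • b j ∈ iSup T
    generalize b.repr x j = a
    have ha : a ∈ iSup 𝒜 := h𝒜 ▸ Submodule.mem_top
    induction ha using Submodule.iSup_induction' with
    | mem c a ha =>
      exact Submodule.mem_iSup_of_mem (c + deg j) (Submodule.subset_span ⟨c, j, rfl, a, ha, rfl⟩)
    | zero => simp
    | add a a' _ _ h h' => rw [add_smul]; exact add_mem h h'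
  have hle : ∀ e, ∀ x ∈ T e, AddMonoidHom.id N x ∈ 𝒩 (e + 0) := by
    intro e x hx
    rw [add_zero]
    refine Submodule.span_le.2 ?_ hx
    rintro _ ⟨c, j, rfl, a, ha, rfl⟩
    exact hN.smul_mem _ _ _ _ ha (hb j)
  -- The spans `T e` fill `N` and satisfy `T e ≤ 𝒩 e`; independence of `𝒩` then forces equality, by
  -- the previous lemma for the identity.
  obtain ⟨x', hx', h⟩ := exists_mem_map_eq_of_map_mem hT hN.isInternal.submodule_iSupIndep
    (AddMonoidHom.id N) (c := 0) hle (x := x) (e := e) (by simpa using hx)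
  obtain rfl : x' = x := h
  exact hx'

/-- Graded projectivity of a free module: choose homogeneous preimages of the images of basis
vectors and extend linearly. Semilinearity along `σ` lets the same lemma lift through differentials
and through the augmentation to `k`. -/
theorem exists_graded_lift [IsScalarTower k A N] (h𝒜 : iSup 𝒜 = ⊤) (hN : IsGradedModule 𝒜 𝒩)
    (hfree : ∃ (ι : Type w) (b : Module.Basis ι A N), ∀ j, ∃ e, b j ∈ 𝒩 e)
    {Z : Type*} [AddCommGroup Z] [Module k Z] [Module A Z] [IsScalarTower k A Z]
    {𝒵 : ℤ → Submodule k Z} (hZ : IsGradedModule 𝒜 𝒵)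
    {B : Type*} [Semiring B] {σ : A →+* B} {Y : Type*} [AddCommGroup Y] [Module k Y] [Module B Y]
    {𝒴 : ℤ → Submodule k Y} (h𝒴 : iSupIndep 𝒴)
    (h : Z →ₛₗ[σ] Y) (hh : ∀ e, ∀ z ∈ 𝒵 e, h z ∈ 𝒴 e)
    {c : ℤ} (f : N →ₛₗ[σ] Y) (hf : ∀ e, ∀ x ∈ 𝒩 e, f x ∈ 𝒴 (e + c))
    (hfh : ∀ x, f x ∈ Set.range h) :
    ∃ s : N →ₗ[A] Z, (∀ e, ∀ x ∈ 𝒩 e, s x ∈ 𝒵 (e + c)) ∧ ∀ x, h (s x) = f x := by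
  obtain ⟨ι, b, hb⟩ := hfree
  choose deg hb using hb
  have key : ∀ j, ∃ z ∈ 𝒵 (deg j + c), h z = f (b j) := by
    intro j
    obtain ⟨z, hz⟩ := hfh (b j)
    obtain ⟨z', hz', h'⟩ := exists_mem_map_eq_of_map_mem
      hZ.isInternal.submodule_iSup_eq_top h𝒴 h.toAddMonoidHom (c := 0)
      (fun e z hz => by rw [add_zero]; exact hh e z hz) (x := z) (e := deg j + c)
      (by rw [add_zero]; exact hz ▸ hf _ _ (hb j))
    exact ⟨z', hz', h'.trans hz⟩
  choose z hz hzf using key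
  refine ⟨b.constr ℕ z, fun e x hx => ?_, fun x => ?_⟩
  · have hx' := mem_span_smul_basis h𝒜 hN b hb hx
    clear hx
    induction hx' using Submodule.span_induction with
    | mem x hx =>
      obtain ⟨m, j, rfl, a, ha, rfl⟩ := hx
      rw [map_smul, b.constr_basis, add_assoc]
      exact hZ.smul_mem _ _ _ _ ha (hz j)
    | zero => simp
    | add x y _ _ hx hy => rw [map_add]; exact add_mem hx hy
    | smul r x _ hx =>
      rw [show b.constr ℕ z (r • x) = r • b.constr ℕ z x from
        ((b.constr ℕ z).restrictScalars k).map_smul r x]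
      exact Submodule.smul_mem _ _ hx
  · have : h.comp (b.constr ℕ z) = f := b.ext fun j => by
      rw [LinearMap.comp_apply, b.constr_basis, hzf]
    exact LinearMap.congr_fun this x

variable {M : Type*} [AddCommGroup M] [Module k M] [Module A M] [IsScalarTower k A M]
  {ℳ : ℤ → Submodule k M}

theorem iSup_tensorDegree (hM : iSup ℳ = ⊤) (hN : iSup 𝒩 = ⊤) :
    iSup (tensorDegree A ℳ 𝒩) = ⊤ := by
  rw [eq_top_iff]
  rintro z -
  induction z using TensorProduct.induction_on with
  | zero => exact zero_mem _
  | add x y hx hy => exact add_mem hx hy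
  | tmul m x =>
    have hm : m ∈ iSup ℳ := hM ▸ Submodule.mem_top
    have hx : x ∈ iSup 𝒩 := hN ▸ Submodule.mem_top
    induction hm using Submodule.iSup_induction' with
    | zero => simp
    | add m m' _ _ h h' => rw [TensorProduct.add_tmul]; exact add_mem h h'
    | mem a m hm =>
      induction hx using Submodule.iSup_induction' with
      | zero => simp
      | add m m' _ _ h h' => rw [TensorProduct.tmul_add]; exact add_mem h h'
      | mem b x hx =>
        exact Submodule.mem_iSup_of_mem (a + b)
          (Submodule.subset_span ⟨a, b, rfl, m, hm, x, hx, rfl⟩)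

/-- A homogeneous basis of `N` identifies `M ⊗ N` with a direct sum of copies of `M`, the `j`-th one
shifted by `deg j`; independence is then inherited coordinatewise from `ℳ`. -/
theorem iSupIndep_tensorDegree [IsScalarTower k A N] (h𝒜 : iSup 𝒜 = ⊤) (hM : IsGradedModule 𝒜 ℳ)
    (hN : IsGradedModule 𝒜 𝒩)
    (hfree : ∃ (ι : Type w) (b : Module.Basis ι A N), ∀ j, ∃ e, b j ∈ 𝒩 e) :
    iSupIndep (tensorDegree A ℳ 𝒩) := by
  classical
  obtain ⟨ι, b, hb⟩ := hfree
  choose deg hb using hb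
  let E (j : ι) : M ⊗[A] N →ₗ[k] M :=
    ((Finsupp.lapply j).comp
      (TensorProduct.equivFinsuppOfBasisRight (M := M) b).toLinearMap).restrictScalars k
  have hE (j : ι) (m : M) (x : N) : E j (m ⊗ₜ[A] x) = b.repr x j • m :=
    TensorProduct.equivFinsuppOfBasisRight_apply_tmul_apply b m x j
  have hdeg (j : ι) (t : ℤ) : tensorDegree A ℳ 𝒩 t ≤ (ℳ (t - deg j)).comap (E j) := by
    refine Submodule.span_le.2 ?_
    rintro _ ⟨a, e, rfl, m, hm, x, hx, rfl⟩
    have hx' := mem_span_smul_basis h𝒜 hN b hb hx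
    clear hx
    change E j (m ⊗ₜ x) ∈ ℳ _
    rw [hE]
    induction hx' using Submodule.span_induction with
    | mem x hx =>
      obtain ⟨c, j', rfl, a', ha', rfl⟩ := hx
      rw [map_smul, b.repr_self, Finsupp.smul_apply, Finsupp.single_apply]
      split_ifs with h
      · subst h
        rw [smul_eq_mul, mul_one, show a + (c + deg j') - deg j' = c + a by ring]
        exact hM.smul_mem _ _ _ _ ha' hm
      · simp
    | zero => simp
    | add x y _ _ hx hy => rw [map_add, Finsupp.add_apply, add_smul]; exact add_mem hx hy
    | smul r x _ hx =>
      rw [← algebraMap_smul A r x, map_smul, Finsupp.smul_apply, smul_assoc, algebraMap_smul]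
      exact Submodule.smul_mem _ _ hx
  intro t
  rw [Submodule.disjoint_def]
  intro z hz hz'
  apply (TensorProduct.equivFinsuppOfBasisRight (M := M) b).injective
  rw [map_zero]
  ext j
  refine Submodule.disjoint_def.1 (hM.isInternal.submodule_iSupIndep (t - deg j)) (E j z)
    (hdeg j t hz) ?_
  have hle : (⨆ t', ⨆ (_ : t' ≠ t), tensorDegree A ℳ 𝒩 t') ≤
      (⨆ e, ⨆ (_ : e ≠ t - deg j), ℳ e).comap (E j) := by
    refine iSup₂_le fun t' ht' y hy => ?_
    exact Submodule.mem_iSup_of_mem (t' - deg j)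
      (Submodule.mem_iSup_of_mem (by omega) (hdeg j t' hy))
  exact hle hz'

theorem lTensor_mem_tensorDegree {Z : Type*} [AddCommGroup Z] [Module k Z] [Module A Z]
    [IsScalarTower k A Z] {𝒵 : ℤ → Submodule k Z} {s : N →ₗ[A] Z} {c : ℤ}
    (hs : ∀ e, ∀ x ∈ 𝒩 e, s x ∈ 𝒵 (e + c)) {t : ℤ} {z : M ⊗[A] N}
    (hz : z ∈ tensorDegree A ℳ 𝒩 t) : s.lTensor M z ∈ tensorDegree A ℳ 𝒵 (t + c) := by
  unfold tensorDegree at hz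
  induction hz using Submodule.span_induction with
  | mem z hz =>
    obtain ⟨a, b, hab, m, hm, x, hx, rfl⟩ := hz
    exact Submodule.subset_span ⟨a, b + c, by omega, m, hm, s x, hs b x hx, by simp⟩
  | zero => simp
  | add x y _ _ hx hy => rw [map_add]; exact add_mem hx hy
  | smul r x _ hx =>
    have : s.lTensor M (r • x) = r • s.lTensor M x :=
      ((s.lTensor M).restrictScalars k).map_smul r x
    rw [this]; exact Submodule.smul_mem _ _ hx

end GradedLifting

/-! ### Comparison maps and homotopies between graded resolutions. -/

namespace GradedFreeResolution

variable {k : Type u} {A : Type v} [Field k] [CommRing A] [Algebra k A]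
  {𝒜 : ℕ → Submodule k A} {aug : A →ₐ[k] k}

theorem d_d (P : GradedFreeResolution 𝒜 aug) (i : ℕ) (x : P.X (i + 2)) :
    P.d i (P.d (i + 1) x) = 0 :=
  (P.exact_succ i _).2 ⟨x, rfl⟩

theorem ε_d (P : GradedFreeResolution 𝒜 aug) (x : P.X 1) : P.ε (P.d 0 x) = 0 :=
  (P.exact_zero _).2 ⟨x, rfl⟩

theorem iSupIndep_gr (P : GradedFreeResolution 𝒜 aug) (i : ℕ) : iSupIndep (P.gr i) :=
  (P.graded i).isInternal.submodule_iSupIndep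

/-- The comparison theorem: the identity of `k` lifts to a map of graded resolutions. -/
theorem exists_comparison (h𝒜 : iSup 𝒜 = ⊤) (P : GradedFreeResolution.{u, v, w} 𝒜 aug)
    (Q : GradedFreeResolution.{u, v, w} 𝒜 aug) :
    ∃ α : ∀ i, P.X i →ₗ[A] Q.X i, (∀ i e, ∀ x ∈ P.gr i e, α i x ∈ Q.gr i e) ∧
      (∀ x, Q.ε (α 0 x) = P.ε x) ∧ ∀ i x, Q.d i (α (i + 1) x) = α i (P.d i x) := by
  -- The recursion carries, along with each map, the fact that it sends boundaries to boundaries;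
  -- this is the range condition needed for the next lift.
  let G (i : ℕ) : Type _ := {α : P.X i →ₗ[A] Q.X i // (∀ e, ∀ x ∈ P.gr i e, α x ∈ Q.gr i e) ∧
    ∀ x, α (P.d i x) ∈ Set.range (Q.d i)}
  let 𝒴 : ℤ → Submodule k k := fun e => if e = 0 then ⊤ else ⊥
  have h𝒴 (R : GradedFreeResolution.{u, v, w} 𝒜 aug) (e : ℤ) (x) (hx : x ∈ R.gr 0 e) :
      R.ε x ∈ 𝒴 e := by
    by_cases he : e = 0
    · simp [𝒴, he]
    · rw [R.ε_eq_zero e x he hx]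
      exact zero_mem _
  obtain ⟨α₀, hα₀, hε⟩ := exists_graded_lift h𝒜 (P.graded 0) (P.free 0) (Q.graded 0) (𝒴 := 𝒴)
    iSupIndep_degree_zero Q.ε (h𝒴 Q) (c := 0) P.ε (by simpa using h𝒴 P) fun x => Q.ε_surjective _
  have step (i : ℕ) (α : G i) : ∃ β : G (i + 1), ∀ x, Q.d i (β.1 x) = α.1 (P.d i x) := by
    obtain ⟨β, hβ, hd⟩ := exists_graded_lift h𝒜 (P.graded (i + 1)) (P.free (i + 1))
      (Q.graded (i + 1)) (Q.iSupIndep_gr i) (Q.d i) (Q.d_mem i) (c := 0) (α.1.comp (P.d i))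
      (by simpa using fun e x hx => α.2.1 _ _ (P.d_mem i e x hx)) α.2.2
    refine ⟨⟨β, by simpa using hβ, fun x => (Q.exact_succ i _).1 ?_⟩, hd⟩
    rw [hd, LinearMap.comp_apply, d_d, map_zero]
  choose next hnext using step
  let α (i : ℕ) : G i := Nat.rec ⟨α₀, by simpa using hα₀, fun x => (Q.exact_zero _).1
    (by rw [hε, ε_d])⟩ next i
  exact ⟨fun i => (α i).1, fun i => (α i).2.1, hε, fun i => hnext i (α i)⟩

/-- A homogeneous chain map between graded resolutions lifting the zero map of `k` is
nullhomotopic. -/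
theorem exists_nullhomotopy (h𝒜 : iSup 𝒜 = ⊤) (P : GradedFreeResolution.{u, v, w} 𝒜 aug)
    (Q : GradedFreeResolution.{u, v, w} 𝒜 aug) {c : ℤ} (α : ∀ i, P.X i →ₗ[A] Q.X i)
    (hα : ∀ i e, ∀ x ∈ P.gr i e, α i x ∈ Q.gr i (e + c)) (hε : ∀ x, Q.ε (α 0 x) = 0)
    (hd : ∀ i x, Q.d i (α (i + 1) x) = α i (P.d i x)) :
    ∃ s : ∀ i, P.X i →ₗ[A] Q.X (i + 1), (∀ i e, ∀ x ∈ P.gr i e, s i x ∈ Q.gr (i + 1) (e + c)) ∧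
      (∀ x, Q.d 0 (s 0 x) = α 0 x) ∧
      ∀ i x, Q.d (i + 1) (s (i + 1) x) = α (i + 1) x - s i (P.d i x) := by
  -- The invariant says that the error left after stage `i` is a boundary, so that it can be lifted
  -- to define the homotopy at stage `i + 1`.
  let G (i : ℕ) : Type _ := {s : P.X i →ₗ[A] Q.X (i + 1) //
    (∀ e, ∀ x ∈ P.gr i e, s x ∈ Q.gr (i + 1) (e + c)) ∧
    ∀ x, α (i + 1) x - s (P.d i x) ∈ Set.range (Q.d (i + 1))}
  obtain ⟨s₀, hs₀, h₀⟩ := exists_graded_lift h𝒜 (P.graded 0) (P.free 0) (Q.graded 1)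
    (Q.iSupIndep_gr 0) (Q.d 0) (Q.d_mem 0) (α 0) (hα 0) fun x => (Q.exact_zero _).1 (hε x)
  have step (i : ℕ) (s : G i) :
      ∃ s' : G (i + 1), ∀ x, Q.d (i + 1) (s'.1 x) = α (i + 1) x - s.1 (P.d i x) := by
    obtain ⟨s', hs', h⟩ := exists_graded_lift h𝒜 (P.graded (i + 1)) (P.free (i + 1))
      (Q.graded (i + 2)) (Q.iSupIndep_gr (i + 1)) (Q.d (i + 1)) (Q.d_mem (i + 1)) (c := c)
      (α (i + 1) - s.1.comp (P.d i))
      (fun e x hx => sub_mem (hα _ _ _ hx) (s.2.1 _ _ (P.d_mem i e x hx))) s.2.2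
    refine ⟨⟨s', hs', fun x => (Q.exact_succ (i + 1) _).1 ?_⟩, h⟩
    rw [map_sub, h, hd, LinearMap.sub_apply, LinearMap.comp_apply, d_d, map_zero, sub_zero,
      sub_self]
  choose next hnext using step
  let s (i : ℕ) : G i := Nat.rec ⟨s₀, hs₀, fun x => (Q.exact_succ 0 _).1
    (by rw [map_sub, h₀, hd, sub_self])⟩ next i
  exact ⟨fun i => (s i).1, fun i => (s i).2.1, h₀, fun i => hnext i (s i)⟩

end GradedFreeResolution

/-! ### Maps on `Tor` induced by chain maps, possibly between complexes over different rings. -/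

namespace GradedFreeResolution

section TorMaps

variable {k : Type*} [Field k] {M : Type*} [AddCommGroup M] [Module k M]
  {A : Type*} [CommRing A] [Algebra k A] {𝒜 : ℕ → Submodule k A} {aug : A →ₐ[k] k}
  [Module A M] [IsScalarTower k A M]
  {B : Type*} [CommRing B] [Algebra k B] {ℬ : ℕ → Submodule k B} {aug' : B →ₐ[k] k}
  [Module B M] [IsScalarTower k B M]
  {ℳ : ℤ → Submodule k M}

section Basic

variable (P : GradedFreeResolution 𝒜 aug)

/-- The class in `Tor` of a cycle. -/
noncomputable def torMk {i : ℕ} {t : ℤ} (z : M ⊗[A] P.X i) (hz : z ∈ P.cycles ℳ i t) :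
    P.Tor ℳ i t :=
  Submodule.Quotient.mk ⟨z, hz⟩

variable {P}

theorem exists_torMk {i : ℕ} {t : ℤ} (ξ : P.Tor ℳ i t) : ∃ z hz, P.torMk z hz = ξ := by
  obtain ⟨⟨z, hz⟩, rfl⟩ := Submodule.Quotient.mk_surjective _ ξ
  exact ⟨z, hz, rfl⟩

theorem torMk_eq_zero {i : ℕ} {t : ℤ} {z : M ⊗[A] P.X i} {hz : z ∈ P.cycles ℳ i t} :
    P.torMk z hz = 0 ↔ z ∈ P.boundaries ℳ i t := by
  rw [torMk, Submodule.Quotient.mk_eq_zero]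
  rfl

theorem torMk_eq_torMk {i : ℕ} {t : ℤ} {z z' : M ⊗[A] P.X i} {hz : z ∈ P.cycles ℳ i t}
    {hz' : z' ∈ P.cycles ℳ i t} :
    P.torMk z hz = P.torMk z' hz' ↔ z - z' ∈ P.boundaries ℳ i t := by
  rw [torMk, torMk, Submodule.Quotient.eq]
  rfl

theorem tensorDegree_of_mem_cycles {i : ℕ} {t : ℤ} {z : M ⊗[A] P.X i}
    (hz : z ∈ P.cycles ℳ i t) : z ∈ tensorDegree A ℳ (P.gr i) t := by
  cases i with
  | zero => exact hz
  | succ i => exact hz.1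

theorem tensorD_tensorD (i : ℕ) (z : M ⊗[A] P.X (i + 2)) :
    P.tensorD M i (P.tensorD M (i + 1) z) = 0 := by
  change (P.d i).lTensor M ((P.d (i + 1)).lTensor M z) = 0
  rw [← LinearMap.lTensor_comp_apply, show (P.d i).comp (P.d (i + 1)) = 0 from
    LinearMap.ext (P.d_d i), LinearMap.lTensor_zero, LinearMap.zero_apply]

theorem tensorD_mem_tensorDegree {i : ℕ} {t : ℤ} {z : M ⊗[A] P.X (i + 1)}
    (hz : z ∈ tensorDegree A ℳ (P.gr (i + 1)) t) :
    P.tensorD M i z ∈ tensorDegree A ℳ (P.gr i) t := by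
  have := lTensor_mem_tensorDegree (s := P.d i) (c := 0) (by simpa using P.d_mem i) hz
  rwa [add_zero] at this

theorem tensorD_mem_cycles {i : ℕ} {t : ℤ} {z : M ⊗[A] P.X (i + 1)}
    (hz : z ∈ tensorDegree A ℳ (P.gr (i + 1)) t) : P.tensorD M i z ∈ P.cycles ℳ i t := by
  cases i with
  | zero => exact tensorD_mem_tensorDegree hz
  | succ i => exact ⟨tensorD_mem_tensorDegree hz, tensorD_tensorD i z⟩

end Basic

variable {P : GradedFreeResolution 𝒜 aug} {Q : GradedFreeResolution ℬ aug'}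

theorem chainMap_mem_cycles (F : ∀ i, M ⊗[A] P.X i →ₗ[k] M ⊗[B] Q.X i) {t t' : ℤ}
    (hF : ∀ i, ∀ z ∈ tensorDegree A ℳ (P.gr i) t, F i z ∈ tensorDegree B ℳ (Q.gr i) t')
    (hd : ∀ i z, Q.tensorD M i (F (i + 1) z) = F i (P.tensorD M i z)) {i : ℕ}
    {z : M ⊗[A] P.X i} (hz : z ∈ P.cycles ℳ i t) : F i z ∈ Q.cycles ℳ i t' := by
  cases i with
  | zero => exact hF 0 z hz
  | succ i =>
    refine ⟨hF _ z hz.1, ?_⟩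
    rw [SetLike.mem_coe, LinearMap.mem_ker, hd, show P.tensorD M i z = 0 from hz.2, map_zero]

theorem mem_cycles_of_injective (F : ∀ i, M ⊗[A] P.X i →ₗ[k] M ⊗[B] Q.X i) {t t' : ℤ}
    (hF : ∀ i, Function.Injective (F i))
    (hd : ∀ i z, Q.tensorD M i (F (i + 1) z) = F i (P.tensorD M i z)) {i : ℕ}
    {z : M ⊗[A] P.X i} (hz : z ∈ tensorDegree A ℳ (P.gr i) t)
    (hFz : F i z ∈ Q.cycles ℳ i t') : z ∈ P.cycles ℳ i t := by
  cases i with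
  | zero => exact hz
  | succ i =>
    refine ⟨hz, hF i ?_⟩
    rw [map_zero, ← hd]
    exact hFz.2

theorem chainMap_mem_boundaries (F : ∀ i, M ⊗[A] P.X i →ₗ[k] M ⊗[B] Q.X i) {t t' : ℤ}
    (hF : ∀ i, ∀ z ∈ tensorDegree A ℳ (P.gr i) t, F i z ∈ tensorDegree B ℳ (Q.gr i) t')
    (hd : ∀ i z, Q.tensorD M i (F (i + 1) z) = F i (P.tensorD M i z)) {i : ℕ}
    {z : M ⊗[A] P.X i} (hz : z ∈ P.boundaries ℳ i t) : F i z ∈ Q.boundaries ℳ i t' := by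
  obtain ⟨y, hy, rfl⟩ := hz
  exact ⟨F (i + 1) y, hF _ y hy, hd i y⟩

/-- The map on `Tor` induced by a map of complexes. -/
noncomputable def torChainMap (F : ∀ i, M ⊗[A] P.X i →ₗ[k] M ⊗[B] Q.X i) {t t' : ℤ}
    (hF : ∀ i, ∀ z ∈ tensorDegree A ℳ (P.gr i) t, F i z ∈ tensorDegree B ℳ (Q.gr i) t')
    (hd : ∀ i z, Q.tensorD M i (F (i + 1) z) = F i (P.tensorD M i z)) (i : ℕ) :
    P.Tor ℳ i t →ₗ[k] Q.Tor ℳ i t' :=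
  Submodule.mapQ _ _
    ((F i).restrict (p := P.cycles ℳ i t) (q := Q.cycles ℳ i t')
      fun _ hz => chainMap_mem_cycles F hF hd hz)
    fun _ hz => chainMap_mem_boundaries F hF hd hz

theorem torChainMap_torMk (F : ∀ i, M ⊗[A] P.X i →ₗ[k] M ⊗[B] Q.X i) {t t' : ℤ}
    (hF : ∀ i, ∀ z ∈ tensorDegree A ℳ (P.gr i) t, F i z ∈ tensorDegree B ℳ (Q.gr i) t')
    (hd : ∀ i z, Q.tensorD M i (F (i + 1) z) = F i (P.tensorD M i z)) {i : ℕ}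
    {z : M ⊗[A] P.X i} (hz : z ∈ P.cycles ℳ i t) :
    torChainMap F hF hd i (P.torMk z hz) =
      Q.torMk (F i z) (chainMap_mem_cycles F hF hd hz) :=
  rfl

end TorMaps

/-! ### Independence of `Tor` from the resolution. -/

section Comparison

variable {k : Type u} {A : Type v} [Field k] [CommRing A] [Algebra k A]
  {𝒜 : ℕ → Submodule k A} {aug : A →ₐ[k] k}
  {M : Type*} [AddCommGroup M] [Module k M] [Module A M] [IsScalarTower k A M]
  {ℳ : ℤ → Submodule k M}

/-- On a cycle the term `s ∘ d` of the homotopy identity vanishes after tensoring, leaving `α z = d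
(s z)`. -/
theorem lTensor_mem_boundaries_of_nullhomotopy {P Q : GradedFreeResolution.{u, v, w} 𝒜 aug} {c : ℤ}
    (α : ∀ i, P.X i →ₗ[A] Q.X i) (s : ∀ i, P.X i →ₗ[A] Q.X (i + 1))
    (hs : ∀ i e, ∀ x ∈ P.gr i e, s i x ∈ Q.gr (i + 1) (e + c))
    (h₀ : ∀ x, Q.d 0 (s 0 x) = α 0 x)
    (h : ∀ i x, Q.d (i + 1) (s (i + 1) x) = α (i + 1) x - s i (P.d i x)) {i : ℕ} {t : ℤ}
    {z : M ⊗[A] P.X i} (hz : z ∈ P.cycles ℳ i t) :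
    (α i).lTensor M z ∈ Q.boundaries ℳ i (t + c) := by
  refine ⟨(s i).lTensor M z,
    lTensor_mem_tensorDegree (hs i) (tensorDegree_of_mem_cycles hz), ?_⟩
  change (Q.d i).lTensor M ((s i).lTensor M z) = _
  rw [← LinearMap.lTensor_comp_apply]
  cases i with
  | zero => rw [show (Q.d 0).comp (s 0) = α 0 from LinearMap.ext h₀]
  | succ i =>
    rw [show (Q.d (i + 1)).comp (s (i + 1)) = α (i + 1) - (s i).comp (P.d i) from
      LinearMap.ext (h i), LinearMap.lTensor_sub, LinearMap.sub_apply,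
      LinearMap.lTensor_comp_apply,
      show (P.d i).lTensor M z = 0 from hz.2, map_zero, sub_zero]

theorem tensorD_lTensor {P Q : GradedFreeResolution.{u, v, w} 𝒜 aug} {α : ∀ i, P.X i →ₗ[A] Q.X i}
    (hd : ∀ i x, Q.d i (α (i + 1) x) = α i (P.d i x)) (i : ℕ) (z : M ⊗[A] P.X (i + 1)) :
    Q.tensorD M i (((α (i + 1)).lTensor M).restrictScalars k z) =
      ((α i).lTensor M).restrictScalars k (P.tensorD M i z) := by
  change (Q.d i).lTensor M ((α (i + 1)).lTensor M z) = (α i).lTensor M ((P.d i).lTensor M z)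
  rw [← LinearMap.lTensor_comp_apply, ← LinearMap.lTensor_comp_apply,
    show (Q.d i).comp (α (i + 1)) = (α i).comp (P.d i) from LinearMap.ext (hd i)]

/-- Homogeneous chain endomorphisms lifting the identity of `k` induce the identity on `Tor`. -/
theorem lTensor_sub_self_mem_boundaries (h𝒜 : iSup 𝒜 = ⊤)
    {P : GradedFreeResolution.{u, v, w} 𝒜 aug} (α : ∀ i, P.X i →ₗ[A] P.X i)
    (hα : ∀ i e, ∀ x ∈ P.gr i e, α i x ∈ P.gr i e) (hε : ∀ x, P.ε (α 0 x) = P.ε x)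
    (hd : ∀ i x, P.d i (α (i + 1) x) = α i (P.d i x)) {i : ℕ} {t : ℤ}
    {z : M ⊗[A] P.X i} (hz : z ∈ P.cycles ℳ i t) :
    (α i).lTensor M z - z ∈ P.boundaries ℳ i t := by
  obtain ⟨s, hs, h₀, h⟩ := exists_nullhomotopy h𝒜 P P (c := 0) (fun i => α i - LinearMap.id)
    (fun i e x hx => by rw [add_zero]; exact sub_mem (hα i e x hx) hx)
    (fun x => by rw [LinearMap.sub_apply, map_sub, hε]; exact sub_self _)
    (fun i x => by
      rw [LinearMap.sub_apply, map_sub, hd]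
      rfl)
  have := lTensor_mem_boundaries_of_nullhomotopy (fun i => α i - LinearMap.id) s hs h₀ h hz
  rwa [LinearMap.lTensor_sub, LinearMap.lTensor_id, add_zero] at this

/-- `Tor` does not depend on the resolution, naturally in the module. -/
theorem exists_torEquiv (h𝒜 : iSup 𝒜 = ⊤) (P Q : GradedFreeResolution.{u, v, w} 𝒜 aug)
    (ℳ : ℤ → Submodule k M) :
    ∃ θ : ∀ i t, P.Tor ℳ i t ≃ₗ[k] Q.Tor ℳ i t,
      ∀ (φ : M →ₗ[A] M) (c : ℤ) (hφ : ∀ e, ∀ m ∈ ℳ e, φ m ∈ ℳ (e + c)) (i : ℕ) (t : ℤ) ξ,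
        θ i (t + c) (P.torMap φ c hφ i t ξ) = Q.torMap φ c hφ i t (θ i t ξ) := by
  obtain ⟨α, hα, hαε, hαd⟩ := exists_comparison h𝒜 P Q
  obtain ⟨β, hβ, hβε, hβd⟩ := exists_comparison h𝒜 Q P
  have hdeg {P Q : GradedFreeResolution.{u, v, w} 𝒜 aug} {α : ∀ i, P.X i →ₗ[A] Q.X i}
      (hα : ∀ i e, ∀ x ∈ P.gr i e, α i x ∈ Q.gr i e) (t : ℤ) (i : ℕ) (z : M ⊗[A] P.X i)
      (hz : z ∈ tensorDegree A ℳ (P.gr i) t) :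
      ((α i).lTensor M).restrictScalars k z ∈ tensorDegree A ℳ (Q.gr i) t := by
    simpa using lTensor_mem_tensorDegree (s := α i) (c := 0) (by simpa using hα i) hz
  let a (i t) : P.Tor ℳ i t →ₗ[k] Q.Tor ℳ i t :=
    torChainMap (fun i => ((α i).lTensor M).restrictScalars k) (hdeg hα t) (tensorD_lTensor hαd) i
  let b (i t) : Q.Tor ℳ i t →ₗ[k] P.Tor ℳ i t :=
    torChainMap (fun i => ((β i).lTensor M).restrictScalars k) (hdeg hβ t) (tensorD_lTensor hβd) i
  have hab (i t) : (a i t).comp (b i t) = LinearMap.id := by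
    refine LinearMap.ext fun ξ => ?_
    obtain ⟨z, hz, rfl⟩ := exists_torMk ξ
    refine torMk_eq_torMk.2 ?_
    have := lTensor_sub_self_mem_boundaries h𝒜 (fun i => (α i).comp (β i))
      (fun i e x hx => hα _ _ _ (hβ _ _ _ hx)) (fun x => (hαε _).trans (hβε _))
      (fun i x => (hαd _ _).trans (congrArg (α i) (hβd _ _))) hz
    rwa [LinearMap.lTensor_comp_apply] at this
  have hba (i t) : (b i t).comp (a i t) = LinearMap.id := by
    refine LinearMap.ext fun ξ => ?_
    obtain ⟨z, hz, rfl⟩ := exists_torMk ξ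
    refine torMk_eq_torMk.2 ?_
    have := lTensor_sub_self_mem_boundaries h𝒜 (fun i => (β i).comp (α i))
      (fun i e x hx => hβ _ _ _ (hα _ _ _ hx)) (fun x => (hβε _).trans (hαε _))
      (fun i x => (hβd _ _).trans (congrArg (β i) (hαd _ _))) hz
    rwa [LinearMap.lTensor_comp_apply] at this
  refine ⟨fun i t => LinearEquiv.ofLinearMap (a i t) (b i t) (hab i t) (hba i t), ?_⟩
  intro φ c hφ i t ξ
  obtain ⟨z, hz, rfl⟩ := exists_torMk ξ
  refine torMk_eq_torMk.2 ?_
  -- The comparison map acts on the right factor and `φ` on the left one, so naturality holds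
  -- already on chains.
  have : (α i).lTensor M (φ.rTensor _ z) = φ.rTensor _ ((α i).lTensor M z) := by
    rw [← LinearMap.comp_apply, ← LinearMap.comp_apply, LinearMap.lTensor_comp_rTensor,
      LinearMap.rTensor_comp_lTensor]
  change (α i).lTensor M (φ.rTensor _ z) - φ.rTensor _ ((α i).lTensor M z) ∈ _
  rw [this, sub_self]
  exact zero_mem _

end Comparison

end GradedFreeResolution

/-! ### The long exact sequence and its connecting map. -/

/-- A total linear relation whose indeterminacy vanishes is a linear map. -/
theorem exists_linearMap_of_rel {k V W E : Type*} [Field k] [AddCommGroup V] [Module k V]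
    [AddCommGroup W] [Module k W] [AddCommGroup E] [Module k E] (p : E →ₗ[k] V) (q : E →ₗ[k] W)
    (hp : Function.Surjective p) (hpq : ∀ e, p e = 0 → q e = 0) :
    ∃ g : V →ₗ[k] W, ∀ e, g (p e) = q e := by
  -- Over a field `p` has a linear section; the choice does not matter, since two lifts of one
  -- vector have the same image under `q`.
  obtain ⟨τ, hτ⟩ := p.exists_rightInverse_of_surjective (LinearMap.range_eq_top.2 hp)
  refine ⟨q.comp τ, fun e => ?_⟩
  rw [LinearMap.comp_apply, ← sub_eq_zero, ← map_sub]
  apply hpq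
  rw [map_sub, sub_eq_zero]
  exact LinearMap.congr_fun hτ (p e)

namespace GradedFreeResolution

variable {k : Type*} [Field k] {M : Type*} [AddCommGroup M] [Module k M]
  {A : Type*} [CommRing A] [Algebra k A] {𝒜 : ℕ → Submodule k A} {aug : A →ₐ[k] k}
  [Module A M] [IsScalarTower k A M]
  {B : Type*} [CommRing B] [Algebra k B] {ℬ : ℕ → Submodule k B} {aug' : B →ₐ[k] k}
  [Module B M] [IsScalarTower k B M]
  {ℳ : ℤ → Submodule k M}

/-- The long exact `Tor` sequence of a short exact sequence of complexes
`0 → M ⊗ P → M ⊗ P → M ⊗ Q → 0` whose maps are homogeneous of degrees `1` and `0`. -/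
theorem exists_exact_tor {P : GradedFreeResolution 𝒜 aug} {Q : GradedFreeResolution ℬ aug'}
    (D : ∀ i, M ⊗[A] P.X i →ₗ[k] M ⊗[A] P.X i) (π : ∀ i, M ⊗[A] P.X i →ₗ[k] M ⊗[B] Q.X i)
    (hD : ∀ t i, ∀ z ∈ tensorDegree A ℳ (P.gr i) t, D i z ∈ tensorDegree A ℳ (P.gr i) (t + 1))
    (hπ : ∀ t i, ∀ z ∈ tensorDegree A ℳ (P.gr i) t, π i z ∈ tensorDegree B ℳ (Q.gr i) t)
    (hDd : ∀ i z, P.tensorD M i (D (i + 1) z) = D i (P.tensorD M i z))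
    (hπd : ∀ i z, Q.tensorD M i (π (i + 1) z) = π i (P.tensorD M i z))
    (hDinj : ∀ i, Function.Injective (D i)) (hπD : ∀ i z, π i (D i z) = 0)
    (hDπ : ∀ t i, ∀ z ∈ tensorDegree A ℳ (P.gr i) (t + 1), π i z = 0 →
      ∃ y ∈ tensorDegree A ℳ (P.gr i) t, D i y = z)
    (hπsurj : ∀ t i, ∀ c ∈ tensorDegree B ℳ (Q.gr i) t,
      ∃ z ∈ tensorDegree A ℳ (P.gr i) t, π i z = c) :
    ∃ g : ∀ (i : ℕ) (t : ℤ), Q.Tor ℳ (i + 1) (t + 1) →ₗ[k] P.Tor ℳ i t,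
      (∀ i t, Function.Exact (torChainMap π (hπ (t + 1)) hπd (i + 1)) (g i t)) ∧
      (∀ i t, Function.Exact (g i t) (torChainMap D (hD t) hDd i)) ∧
      (∀ i t, Function.Exact (torChainMap D (hD t) hDd i)
        (torChainMap π (hπ (t + 1)) hπd i)) ∧
      (∀ t, Function.Surjective (torChainMap π (hπ t) hπd 0)) := by
  -- The connecting map comes with a rule valid for every admissible pair `(a, y)`, so each
  -- exactness check may use the pair that suits it.
  have key (i : ℕ) (t : ℤ) : ∃ g : Q.Tor ℳ (i + 1) (t + 1) →ₗ[k] P.Tor ℳ i t,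
      ∀ a ∈ tensorDegree A ℳ (P.gr (i + 1)) (t + 1), ∀ y (hy : y ∈ P.cycles ℳ i t)
        (ha : π (i + 1) a ∈ Q.cycles ℳ (i + 1) (t + 1)),
        P.tensorD M i a = D i y → g (Q.torMk _ ha) = P.torMk y hy := by
    -- The snake relation: pairs `(a, y)` with `d a = D y`, to be sent from the class of `π a` to
    -- the class of `y`.
    let E : Submodule k ((M ⊗[A] P.X (i + 1)) × (M ⊗[A] P.X i)) :=
      ((tensorDegree A ℳ (P.gr (i + 1)) (t + 1)).prod (P.cycles ℳ i t)) ⊓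
        LinearMap.ker ((P.tensorD M i).coprod (-D i))
    have hE (e) (he : e ∈ E) : P.tensorD M i e.1 = D i e.2 := by
      have h : P.tensorD M i e.1 + -D i e.2 = 0 := he.2
      rwa [← sub_eq_add_neg, sub_eq_zero] at h
    have hEc (e : E) : π (i + 1) e.1.1 ∈ Q.cycles ℳ (i + 1) (t + 1) := by
      refine ⟨hπ _ _ _ e.2.1.1, ?_⟩
      rw [SetLike.mem_coe, LinearMap.mem_ker, hπd, hE _ e.2, hπD]
    let p : E →ₗ[k] Q.Tor ℳ (i + 1) (t + 1) := (Submodule.mkQ _).comp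
      (((π (i + 1)).comp ((LinearMap.fst k _ _).comp E.subtype)).codRestrict _ hEc)
    let q : E →ₗ[k] P.Tor ℳ i t := (Submodule.mkQ _).comp
      (((LinearMap.snd k _ _).comp E.subtype).codRestrict _ fun e => e.2.1.2)
    have hmem {a y} (ha : a ∈ tensorDegree A ℳ (P.gr (i + 1)) (t + 1)) (hy : y ∈ P.cycles ℳ i t)
        (h : P.tensorD M i a = D i y) : (a, y) ∈ E := by
      refine ⟨⟨ha, hy⟩, ?_⟩
      change P.tensorD M i a + -D i y = 0
      rw [h, add_neg_cancel]
    obtain ⟨g, hg⟩ := exists_linearMap_of_rel p q (fun ξ => by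
      -- Totality: lift the cycle to `a`; then `π (d a) = 0` gives `d a = D y`, and injectivity of
      -- `D` makes `y` a cycle.
      obtain ⟨c, hc, rfl⟩ := exists_torMk ξ
      obtain ⟨a, ha, rfl⟩ := hπsurj _ _ _ hc.1
      obtain ⟨y, hy, hya⟩ := hDπ t i (P.tensorD M i a) (tensorD_mem_tensorDegree ha)
        (by rw [← hπd]; exact hc.2)
      refine ⟨⟨(a, y), hmem ha (mem_cycles_of_injective D hDinj hDd hy (t' := t + 1) ?_)
        hya.symm⟩, rfl⟩
      rw [hya]
      exact tensorD_mem_cycles ha) (by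
      -- Indeterminacy: if `π a = d (π a')`, then `a - d a' = D x`, so `D (d x) = d a = D y` and `y
      -- = d x` is a boundary.
      rintro ⟨⟨a, y⟩, he⟩ h0
      obtain ⟨c, hc, hca⟩ := torMk_eq_zero.1 h0
      obtain ⟨a', ha', rfl⟩ := hπsurj _ _ _ hc
      rw [hπd] at hca
      change π (i + 1) (P.tensorD M (i + 1) a') = π (i + 1) a at hca
      obtain ⟨x, hx, hxa⟩ := hDπ t (i + 1) (a - P.tensorD M (i + 1) a')
        (sub_mem he.1.1 (tensorD_mem_tensorDegree ha')) (by rw [map_sub, hca, sub_self])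
      refine torMk_eq_zero.2 ⟨x, hx, hDinj i ?_⟩
      rw [← hDd, hxa, map_sub, tensorD_tensorD, sub_zero]
      exact hE _ he)
    exact ⟨g, fun a ha y hy _ h => hg ⟨(a, y), hmem ha hy h⟩⟩
  choose g hg using key
  refine ⟨g, fun i t ξ => ⟨fun h => ?_, ?_⟩, fun i t ξ => ⟨fun h => ?_, ?_⟩,
    fun i t ξ => ⟨fun h => ?_, ?_⟩, fun t ξ => ?_⟩
  · obtain ⟨c, hc, rfl⟩ := exists_torMk ξ
    obtain ⟨a, ha, rfl⟩ := hπsurj _ _ _ hc.1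
    obtain ⟨y, hy, hya⟩ := hDπ t i (P.tensorD M i a) (tensorD_mem_tensorDegree ha)
      (by rw [← hπd]; exact hc.2)
    rw [hg i t a ha y (mem_cycles_of_injective D hDinj hDd hy (t' := t + 1)
      (hya ▸ tensorD_mem_cycles ha)) hc hya.symm] at h
    obtain ⟨x, hx, rfl⟩ := torMk_eq_zero.1 h
    -- Here `y = d x`, so subtracting `D x` corrects the lift `a` to a cycle without changing its
    -- image under `π`.
    have haD : a - D (i + 1) x ∈ P.cycles ℳ (i + 1) (t + 1) := by
      refine ⟨sub_mem ha (hD _ _ _ hx), ?_⟩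
      rw [SetLike.mem_coe, LinearMap.mem_ker, map_sub, hDd, hya, sub_self]
    refine ⟨P.torMk _ haD, ?_⟩
    rw [torChainMap_torMk, torMk_eq_torMk, map_sub, hπD, sub_zero, sub_self]
    exact zero_mem _
  · rintro ⟨η, rfl⟩
    obtain ⟨a, ha, rfl⟩ := exists_torMk η
    -- A lift that is itself a cycle is paired with `y = 0`.
    rw [torChainMap_torMk, hg i t a ha.1 0 (zero_mem _) _ (by rw [map_zero]; exact ha.2),
      torMk_eq_zero]
    exact zero_mem _
  · obtain ⟨y, hy, rfl⟩ := exists_torMk ξ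
    rw [torChainMap_torMk, torMk_eq_zero] at h
    obtain ⟨a, ha, hay⟩ := h
    have hac : π (i + 1) a ∈ Q.cycles ℳ (i + 1) (t + 1) := by
      refine ⟨hπ _ _ _ ha, ?_⟩
      rw [SetLike.mem_coe, LinearMap.mem_ker, hπd, hay, hπD]
    exact ⟨Q.torMk _ hac, hg i t a ha y hy hac hay⟩
  · rintro ⟨η, rfl⟩
    obtain ⟨c, hc, rfl⟩ := exists_torMk η
    obtain ⟨a, ha, rfl⟩ := hπsurj _ _ _ hc.1
    obtain ⟨y, hy, hya⟩ := hDπ t i (P.tensorD M i a) (tensorD_mem_tensorDegree ha)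
      (by rw [← hπd]; exact hc.2)
    have hyc := mem_cycles_of_injective D hDinj hDd hy (t' := t + 1) (hya ▸ tensorD_mem_cycles ha)
    rw [hg i t a ha y hyc hc hya.symm, torChainMap_torMk, torMk_eq_zero]
    exact ⟨a, ha, hya.symm⟩
  · obtain ⟨z, hz, rfl⟩ := exists_torMk ξ
    rw [torChainMap_torMk, torMk_eq_zero] at h
    obtain ⟨c, hc, hcz⟩ := h
    obtain ⟨a, ha, rfl⟩ := hπsurj _ _ _ hc
    rw [hπd] at hcz
    -- Subtracting a boundary moves `z` into the kernel of `π`, hence into the image of `D`, without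
    -- changing its class.
    have hza : z - P.tensorD M i a ∈ P.cycles ℳ i (t + 1) := sub_mem hz (tensorD_mem_cycles ha)
    obtain ⟨y, hy, hyz⟩ := hDπ t i _ (tensorDegree_of_mem_cycles hza)
      (by rw [map_sub, hcz, sub_self])
    refine ⟨P.torMk y (mem_cycles_of_injective D hDinj hDd hy (t' := t + 1) (hyz ▸ hza)), ?_⟩
    rw [torChainMap_torMk, torMk_eq_torMk, hyz, sub_sub_cancel_left]
    exact neg_mem ⟨a, ha, rfl⟩
  · rintro ⟨η, rfl⟩
    obtain ⟨y, hy, rfl⟩ := exists_torMk η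
    rw [torChainMap_torMk, torChainMap_torMk, torMk_eq_zero, hπD]
    exact zero_mem _
  · obtain ⟨c, hc, rfl⟩ := exists_torMk ξ
    obtain ⟨z, hz, rfl⟩ := hπsurj _ _ _ hc
    exact ⟨P.torMk z hz, rfl⟩

end GradedFreeResolution

/-! ### The ring `R` as a graded free module over `S₁`. -/

section PolynomialRings

variable {k : Type u} [Field k] {n : ℕ}

theorem iSup_gradingR : iSup (gradingR k n) = ⊤ := by
  rw [eq_top_iff]
  rintro x -
  rw [← MvPolynomial.sum_homogeneousComponent x]
  exact Submodule.sum_mem _ fun m _ => Submodule.mem_iSup_of_mem m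
    (MvPolynomial.homogeneousComponent_mem m x)

theorem homogeneousComponent_mem_polyS (m : ℕ) (p : PolyS k n) :
    MvPolynomial.homogeneousComponent m (p : PolyR k n) ∈ PolyS k n := by
  rw [MvPolynomial.mem_supported]
  refine subset_trans ?_ (MvPolynomial.mem_supported.1 p.2)
  intro i hi
  rw [Finset.mem_coe, MvPolynomial.mem_vars_iff_mem_support] at hi ⊢
  obtain ⟨d, hd, hi⟩ := hi
  rw [MvPolynomial.support_homogeneousComponent, Finset.mem_filter] at hd
  exact ⟨d, hd.1, hi⟩

theorem iSup_gradingS : iSup (gradingS k n) = ⊤ := by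
  rw [eq_top_iff]
  rintro x -
  have : x = ∑ m ∈ Finset.range ((x : PolyR k n).totalDegree + 1),
      (⟨MvPolynomial.homogeneousComponent m (x : PolyR k n),
        homogeneousComponent_mem_polyS m x⟩ : PolyS k n) := by
    apply Subtype.ext
    rw [AddSubmonoidClass.coe_finsetSum]
    exact (MvPolynomial.sum_homogeneousComponent _).symm
  rw [this]
  exact Submodule.sum_mem _ fun m _ => Submodule.mem_iSup_of_mem m
    (MvPolynomial.homogeneousComponent_mem m (x : PolyR k n))

theorem X_succ_mem_polyS (i : Fin n) : (MvPolynomial.X i.succ : PolyR k n) ∈ PolyS k n :=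
  MvPolynomial.X_mem_supported.2 ⟨i, rfl⟩

/-- With `R` viewed as polynomials in `x₀` over `k[x₁, …, xₙ]`, the constants form a subalgebra
containing the generators of `S₁`. Linear relations over `S₁` among powers of `x₀` can thus be read
off coefficientwise. -/
theorem exists_finSuccEquiv_eq_C (s : PolyS k n) :
    ∃ p, MvPolynomial.finSuccEquiv k n (s : PolyR k n) = Polynomial.C p := by
  have hle : PolyS k n ≤ (Polynomial.CAlgHom (R := k) (A := MvPolynomial (Fin n) k)).range.comap
      (MvPolynomial.finSuccEquiv k n : PolyR k n →ₐ[k] _) := by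
    rw [PolyS, MvPolynomial.supported_eq_adjoin_X, Algebra.adjoin_le_iff]
    rintro _ ⟨_, ⟨i, rfl⟩, rfl⟩
    exact ⟨MvPolynomial.X i, MvPolynomial.finSuccEquiv_X_succ.symm⟩
  obtain ⟨p, hp⟩ := hle s.2
  exact ⟨p, hp.symm⟩

/-- `R` is free over `S₁` on the powers of `x₀`. -/
theorem exists_basis_X0_pow : ∃ b : Module.Basis ℕ (PolyS k n) (PolyR k n),
    ∀ a, b a = (MvPolynomial.X 0 : PolyR k n) ^ a := by
  have hli : LinearIndependent (PolyS k n) fun a : ℕ => (MvPolynomial.X 0 : PolyR k n) ^ a := by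
    rw [linearIndependent_iff]
    intro l hl
    choose p hp using exists_finSuccEquiv_eq_C (k := k) (n := n)
    rw [Finsupp.linearCombination_apply, Finsupp.sum] at hl
    replace hl := congrArg (MvPolynomial.finSuccEquiv k n) hl
    simp only [Subalgebra.smul_def, smul_eq_mul, map_sum, map_mul, map_pow, hp,
      MvPolynomial.finSuccEquiv_X_zero, map_zero] at hl
    ext1 a
    have ha := congrArg (Polynomial.coeff · a) hl
    simp only [Polynomial.finsetSum_coeff, Polynomial.coeff_C_mul, Polynomial.coeff_X_pow,
      mul_ite, mul_one, mul_zero, Finset.sum_ite_eq, Polynomial.coeff_zero] at ha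
    by_cases h : a ∈ l.support
    · rw [if_pos h] at ha
      have h0 : MvPolynomial.finSuccEquiv k n (l a : PolyR k n) = 0 := by rw [hp, ha, map_zero]
      rw [EmbeddingLike.map_eq_zero_iff] at h0
      exact Subtype.ext h0
    · simpa using h
  have hspan : ⊤ ≤ Submodule.span (PolyS k n)
      (Set.range fun a : ℕ => (MvPolynomial.X 0 : PolyR k n) ^ a) := by
    rintro q -
    induction q using MvPolynomial.induction_on with
    | C a =>
      have := Submodule.smul_mem (Submodule.span (PolyS k n)
        (Set.range fun a : ℕ => (MvPolynomial.X 0 : PolyR k n) ^ a))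
        (algebraMap k (PolyS k n) a) (Submodule.subset_span ⟨0, rfl⟩)
      simp only [pow_zero, Subalgebra.smul_def, smul_eq_mul, mul_one] at this
      exact this
    | add p q hp hq => exact add_mem hp hq
    | mul_X p i hp =>
      induction i using Fin.cases with
      | zero =>
        induction hp using Submodule.span_induction with
        | mem p hp =>
          obtain ⟨a, rfl⟩ := hp
          exact Submodule.subset_span ⟨a + 1, pow_succ _ _⟩
        | zero => simp
        | add p q _ _ hp hq => rw [add_mul]; exact add_mem hp hq
        | smul s p _ hp => rw [smul_mul_assoc]; exact Submodule.smul_mem _ _ hp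
      | succ i =>
        rw [mul_comm]
        exact Submodule.smul_mem _ (⟨_, X_succ_mem_polyS i⟩ : PolyS k n) hp
  exact ⟨Module.Basis.mk hli hspan, fun a => by rw [Module.Basis.mk_apply]⟩

/-! ### The short exact sequence from tensor products over `S₁` to tensor products over `R`. -/

variable {M : Type v} [AddCommGroup M] [Module k M] [Module (PolyR k n) M]
  [IsScalarTower k (PolyR k n) M]
  {N : Type w} [AddCommGroup N] [Module k N] [Module (PolyR k n) N] [IsScalarTower k (PolyR k n) N]

variable (k n M N) in
/-- The endomorphism `x₀ ⊗ 1 - 1 ⊗ x₀` of `M ⊗ N` over `S₁`. -/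
noncomputable def X0Commutator : M ⊗[PolyS k n] N →ₗ[k] M ⊗[PolyS k n] N :=
  ((mulX0 k n M).rTensor N - (mulX0 k n N).lTensor M).restrictScalars k

variable (k n M N) in
/-- The projection from the tensor product over `S₁` to the tensor product over `R`. -/
noncomputable def tensorProj : M ⊗[PolyS k n] N →ₗ[k] M ⊗[PolyR k n] N :=
  TensorProduct.mapOfCompatibleSMul (PolyR k n) (PolyS k n) k M N

omit [Module k N] [IsScalarTower k (PolyR k n) N] in
theorem X0Commutator_tmul (m : M) (x : N) : X0Commutator k n M N (m ⊗ₜ x) =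
    ((MvPolynomial.X 0 : PolyR k n) • m) ⊗ₜ x - m ⊗ₜ ((MvPolynomial.X 0 : PolyR k n) • x) :=
  rfl

omit [Module k N] [IsScalarTower k (PolyR k n) N] in
theorem tensorProj_tmul (m : M) (x : N) : tensorProj k n M N (m ⊗ₜ x) = m ⊗ₜ x := rfl

omit [Module k N] [IsScalarTower k (PolyR k n) N] in
theorem tensorProj_X0Commutator (z : M ⊗[PolyS k n] N) :
    tensorProj k n M N (X0Commutator k n M N z) = 0 := by
  induction z using TensorProduct.induction_on with
  | zero => simp
  | add y z hy hz => rw [map_add, map_add, hy, hz, add_zero]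
  | tmul m x =>
    rw [X0Commutator_tmul, map_sub, tensorProj_tmul, tensorProj_tmul, TensorProduct.smul_tmul,
      sub_self]

omit [Module k N] [IsScalarTower k (PolyR k n) N] in
-- As `R` is generated over `S₁` by `x₀`, a map balanced over `S₁` that also lets `x₀` cross the
-- tensor sign is balanced over `R`, so it factors through the tensor product over `R`.
theorem exists_factor_tensorProj {C : Type*} [AddCommGroup C] (q : M ⊗[PolyS k n] N →+ C)
    (hq : ∀ z, q (X0Commutator k n M N z) = 0) :
    ∃ G : M ⊗[PolyR k n] N →+ C, ∀ z, G (tensorProj k n M N z) = q z := by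
  let f : M →+ N →+ C := AddMonoidHom.mk'
    (fun m => q.comp (TensorProduct.mk (PolyS k n) M N m).toAddMonoidHom)
    fun m m' => AddMonoidHom.ext fun x =>
      (congrArg q (TensorProduct.add_tmul m m' x)).trans (map_add q _ _)
  have hf (m : M) (x : N) : f m x = q (m ⊗ₜ x) := rfl
  have hS (s : PolyS k n) (m : M) (x : N) :
      f ((s : PolyR k n) • m) x = f m ((s : PolyR k n) • x) := by
    rw [hf, hf, ← Subalgebra.smul_def, ← Subalgebra.smul_def, TensorProduct.smul_tmul]
  have hX (i) (m : M) (x : N) :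
      f ((MvPolynomial.X i : PolyR k n) • m) x = f m ((MvPolynomial.X i : PolyR k n) • x) := by
    induction i using Fin.cases with
    | zero =>
      rw [hf, hf, ← sub_eq_zero, ← map_sub, ← X0Commutator_tmul, hq]
    | succ i => exact hS ⟨_, X_succ_mem_polyS i⟩ m x
  have hR (r : PolyR k n) (m : M) (x : N) : f (r • m) x = f m (r • x) := by
    induction r using MvPolynomial.induction_on generalizing m x with
    | C a => exact hS (algebraMap k (PolyS k n) a) m x
    | add p q hp hq => rw [add_smul, add_smul, map_add, map_add, AddMonoidHom.add_apply, hp, hq]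
    | mul_X p i hp => rw [mul_smul, hp, hX, smul_smul, mul_comm]
  refine ⟨TensorProduct.liftAddHom f hR, fun z => ?_⟩
  induction z using TensorProduct.induction_on with
  | zero => simp
  | add y z hy hz => rw [map_add, map_add, map_add, hy, hz]
  | tmul m x => rfl

omit [Module k N] [IsScalarTower k (PolyR k n) N] in
-- The quotient map onto the cokernel of `X0Commutator` factors through `tensorProj`, so whatever
-- `tensorProj` kills is zero in that cokernel.
theorem exists_X0Commutator_eq {z : M ⊗[PolyS k n] N} (hz : tensorProj k n M N z = 0) :
    ∃ y, X0Commutator k n M N y = z := by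
  obtain ⟨G, hG⟩ := exists_factor_tensorProj
    (LinearMap.range (X0Commutator k n M N)).mkQ.toAddMonoidHom
    fun y => (Submodule.Quotient.mk_eq_zero _).2 ⟨y, rfl⟩
  have := hG z
  rw [hz, map_zero, eq_comm] at this
  exact (Submodule.Quotient.mk_eq_zero _).1 this

omit [Module k N] [IsScalarTower k (PolyR k n) N] in
-- In coordinates `z (a, j)` along `x₀ ^ a • c j`, a kernel element satisfies `z (a, j) = x₀ • z (a
-- + 1, j)`. Iterating, each coordinate is a multiple of coordinates with arbitrarily large `a`,
-- which vanish by finite support. No regularity of `x₀` on `M` is needed.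
theorem X0Commutator_injective {ι : Type*} (c : Module.Basis ι (PolyR k n) N) :
    Function.Injective (X0Commutator k n M N) := by
  classical
  obtain ⟨b, hb⟩ := exists_basis_X0_pow (k := k) (n := n)
  have hbX (r : PolyR k n) (a : ℕ) : b.repr (MvPolynomial.X 0 * r) (a + 1) = b.repr r a := by
    have : ((Finsupp.lapply (a + 1)).comp b.repr.toLinearMap).comp
        (LinearMap.mulLeft (PolyS k n) (MvPolynomial.X 0 : PolyR k n)) =
        (Finsupp.lapply a).comp b.repr.toLinearMap := by
      refine b.ext fun a' => ?_
      have h : (MvPolynomial.X 0 : PolyR k n) * b a' = b (a' + 1) := by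
        rw [hb, hb, pow_succ']
      simp [h, Finsupp.single_apply]
    exact LinearMap.congr_fun this r
  let E := TensorProduct.equivFinsuppOfBasisRight (M := M) (b.smulTower c)
  have hE (m : M) (x : N) (a : ℕ) (j : ι) : E (m ⊗ₜ x) (a, j) = b.repr (c.repr x j) a • m := by
    rw [TensorProduct.equivFinsuppOfBasisRight_apply_tmul_apply, Module.Basis.smulTower_repr_mk]
  -- Only the positive exponents `a + 1` are compared: there multiplication by `x₀` on `N` shifts
  -- coordinates by one.
  have hED (z) (a : ℕ) (j : ι) : E (X0Commutator k n M N z) (a + 1, j) =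
      mulX0 k n M (E z (a + 1, j)) - E z (a, j) := by
    induction z using TensorProduct.induction_on with
    | zero => simp
    | add y z hy hz =>
      simp only [map_add, Finsupp.add_apply, hy, hz]
      abel
    | tmul m x =>
      rw [X0Commutator_tmul, map_sub, Finsupp.sub_apply, hE, hE, hE, hE, map_smul,
        Finsupp.smul_apply, smul_eq_mul, hbX, map_smul]
      rfl
  rw [injective_iff_map_eq_zero]
  intro z hz
  have h1 (a : ℕ) (j : ι) : E z (a, j) = mulX0 k n M (E z (a + 1, j)) := by
    have := hED z a j
    rw [hz, map_zero, Finsupp.zero_apply] at this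
    exact (sub_eq_zero.1 this.symm).symm
  have h2 (m a : ℕ) (j : ι) (h : E z (a + m, j) = 0) : E z (a, j) = 0 := by
    induction m with
    | zero => exact h
    | succ m ih => exact ih (by rw [h1, show a + m + 1 = a + (m + 1) from rfl, h, map_zero])
  apply E.injective
  rw [map_zero]
  ext ⟨a, j⟩
  -- One more than the largest exponent in the support is a shift that leaves the support from any
  -- starting exponent `a`.
  have hlt : ∀ p ∈ (E z).support, p.1 < (E z).support.sup Prod.fst + 1 := fun p hp =>
    Nat.lt_succ_of_le (Finset.le_sup (f := Prod.fst) hp)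
  refine h2 ((E z).support.sup Prod.fst + 1) a j ?_
  by_contra h
  have := hlt _ (Finsupp.mem_support_iff.2 h)
  dsimp only at this
  omega

omit [Module k N] [IsScalarTower k (PolyR k n) N] in
theorem lTensor_X0Commutator {L : Type*} [AddCommGroup L] [Module k L] [Module (PolyR k n) L]
    [IsScalarTower k (PolyR k n) L] (φ : N →ₗ[PolyR k n] L) (z : M ⊗[PolyS k n] N) :
    (φ.restrictScalars (PolyS k n)).lTensor M (X0Commutator k n M N z) =
      X0Commutator k n M L ((φ.restrictScalars (PolyS k n)).lTensor M z) := by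
  induction z using TensorProduct.induction_on with
  | zero => simp
  | add y z hy hz => simp only [map_add, hy, hz]
  | tmul m x =>
    rw [X0Commutator_tmul, map_sub, LinearMap.lTensor_tmul, LinearMap.lTensor_tmul,
      LinearMap.lTensor_tmul, X0Commutator_tmul]
    simp

omit [Module k N] [IsScalarTower k (PolyR k n) N] in
theorem lTensor_tensorProj {L : Type*} [AddCommGroup L] [Module k L] [Module (PolyR k n) L]
    [IsScalarTower k (PolyR k n) L] (φ : N →ₗ[PolyR k n] L) (z : M ⊗[PolyS k n] N) :
    φ.lTensor M (tensorProj k n M N z) =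
      tensorProj k n M L ((φ.restrictScalars (PolyS k n)).lTensor M z) := by
  induction z using TensorProduct.induction_on with
  | zero => simp
  | add y z hy hz => simp only [map_add, hy, hz]
  | tmul m x => rfl

variable {ℳ : ℤ → Submodule k M} {𝒩 : ℤ → Submodule k N}

theorem X0Commutator_mem_tensorDegree (hM : IsGradedModule (gradingR k n) ℳ)
    (hN : IsGradedModule (gradingR k n) 𝒩) {t : ℤ} {z : M ⊗[PolyS k n] N}
    (hz : z ∈ tensorDegree (PolyS k n) ℳ 𝒩 t) :
    X0Commutator k n M N z ∈ tensorDegree (PolyS k n) ℳ 𝒩 (t + 1) :=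
  sub_mem (GradedFreeResolution.rTensor_mem_tensorDegree (mulX0_mem hM) hz)
    (lTensor_mem_tensorDegree (mulX0_mem hN) hz)

omit [IsScalarTower k (PolyR k n) N] in
theorem map_tensorProj_tensorDegree (t : ℤ) :
    (tensorDegree (PolyS k n) ℳ 𝒩 t).map (tensorProj k n M N) =
      tensorDegree (PolyR k n) ℳ 𝒩 t := by
  rw [tensorDegree, tensorDegree, Submodule.map_span]
  congr 1
  ext z
  constructor
  · rintro ⟨_, ⟨a, b, hab, m, hm, x, hx, rfl⟩, rfl⟩
    exact ⟨a, b, hab, m, hm, x, hx, rfl⟩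
  · rintro ⟨a, b, hab, m, hm, x, hx, rfl⟩
    exact ⟨_, ⟨a, b, hab, m, hm, x, hx, rfl⟩, rfl⟩

omit [IsScalarTower k (PolyR k n) N] in
theorem IsGradedModule.restrictS (hN : IsGradedModule (gradingR k n) 𝒩) :
    IsGradedModule (gradingS k n) 𝒩 :=
  ⟨hN.isInternal, fun c e a m ha hm => hN.smul_mem c e a m ha hm⟩

omit [IsScalarTower k (PolyR k n) N] in
-- Multiply the homogeneous `R`-basis by the powers of `x₀`. This is what makes an `R`-resolution
-- free over `S₁`.
theorem IsGradedModule.exists_homogeneous_basis_polyS (hN : IsGradedModule (gradingR k n) 𝒩)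
    (hfree : ∃ (ι : Type w) (c : Module.Basis ι (PolyR k n) N), ∀ j, ∃ e, c j ∈ 𝒩 e) :
    ∃ (ι : Type w) (c : Module.Basis ι (PolyS k n) N), ∀ j, ∃ e, c j ∈ 𝒩 e := by
  obtain ⟨ι, c, hc⟩ := hfree
  obtain ⟨b, hb⟩ := exists_basis_X0_pow (k := k) (n := n)
  refine ⟨ℕ × ι, b.smulTower c, fun ⟨a, j⟩ => ?_⟩
  obtain ⟨e, he⟩ := hc j
  refine ⟨a + e, ?_⟩
  rw [Module.Basis.smulTower_apply, hb]
  exact hN.smul_mem _ _ _ _ (MvPolynomial.isHomogeneous_X_pow 0 a) he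

/-- Exactness without degrees supplies a preimage; since `X0Commutator` is homogeneous of degree
one, its component of degree `t` already suffices. -/
theorem exists_mem_tensorDegree_X0Commutator_eq (hM : IsGradedModule (gradingR k n) ℳ)
    (hN : IsGradedModule (gradingR k n) 𝒩)
    (hfree : ∃ (ι : Type w) (c : Module.Basis ι (PolyR k n) N), ∀ j, ∃ e, c j ∈ 𝒩 e) {t : ℤ}
    {z : M ⊗[PolyS k n] N} (hz : z ∈ tensorDegree (PolyS k n) ℳ 𝒩 (t + 1))
    (h : tensorProj k n M N z = 0) :
    ∃ y ∈ tensorDegree (PolyS k n) ℳ 𝒩 t, X0Commutator k n M N y = z := by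
  obtain ⟨y, rfl⟩ := exists_X0Commutator_eq h
  exact exists_mem_map_eq_of_map_mem
    (iSup_tensorDegree (A := PolyS k n) hM.isInternal.submodule_iSup_eq_top
      hN.isInternal.submodule_iSup_eq_top)
    (iSupIndep_tensorDegree iSup_gradingS hM.restrictS hN.restrictS
      (hN.exists_homogeneous_basis_polyS hfree))
    (X0Commutator k n M N).toAddMonoidHom
    (fun e x hx => X0Commutator_mem_tensorDegree hM hN hx) hz

/-! ### Restricting a resolution to `S₁`, and the action of `x₀` on it. -/

namespace GradedFreeResolution

/-- A graded free resolution over `R`, regarded as a resolution over `S₁`. -/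
noncomputable def restrictS (Q : GradedFreeResolution.{u, u, w} (gradingR k n) (augR k n)) :
    GradedFreeResolution.{u, u, w} (gradingS k n) (augS k n) where
  X := Q.X
  gr := Q.gr
  graded i := (Q.graded i).restrictS
  free i := (Q.graded i).exists_homogeneous_basis_polyS (Q.free i)
  d i := (Q.d i).restrictScalars (PolyS k n)
  d_mem := Q.d_mem
  ε := { toFun := Q.ε
         map_add' := map_add Q.ε
         map_smul' := fun s x => Q.ε.map_smulₛₗ (s : PolyR k n) x }
  ε_eq_zero := Q.ε_eq_zero
  ε_surjective := Q.ε_surjective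
  exact_zero := Q.exact_zero
  exact_succ := Q.exact_succ

variable (Q : GradedFreeResolution.{u, u, w} (gradingR k n) (augR k n))

/-- Multiplication by `x₀` on `Q` is an `R`-linear chain map of degree one lifting `x₀ = 0` on `k`.
Its nullhomotopy over `R` remains one over `S₁`. -/
theorem lTensor_mulX0_mem_boundaries {i : ℕ} {t : ℤ} {z : M ⊗[PolyS k n] Q.X i}
    (hz : z ∈ Q.restrictS.cycles ℳ i t) :
    (mulX0 k n (Q.X i)).lTensor M z ∈ Q.restrictS.boundaries ℳ i (t + 1) := by
  obtain ⟨s, hs, h₀, h⟩ := exists_nullhomotopy iSup_gradingR Q Q (c := 1)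
    (fun i => LinearMap.lsmul (PolyR k n) (Q.X i) (MvPolynomial.X 0))
    (fun i e x hx => mulX0_mem (Q.graded i) e x hx)
    (fun x => by
      rw [LinearMap.lsmul_apply, map_smulₛₗ]
      simp [augR])
    (fun i x => map_smul (Q.d i) _ x)
  exact lTensor_mem_boundaries_of_nullhomotopy (P := Q.restrictS) (Q := Q.restrictS)
    (fun i => mulX0 k n (Q.X i)) (fun i => (s i).restrictScalars (PolyS k n)) hs h₀ h hz

theorem tensorD_X0Commutator (i : ℕ) (z : M ⊗[PolyS k n] Q.X (i + 1)) :
    Q.restrictS.tensorD M i (X0Commutator k n M (Q.X (i + 1)) z) =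
      X0Commutator k n M (Q.X i) (Q.restrictS.tensorD M i z) :=
  lTensor_X0Commutator (Q.d i) z

theorem tensorD_tensorProj (i : ℕ) (z : M ⊗[PolyS k n] Q.X (i + 1)) :
    Q.tensorD M i (tensorProj k n M (Q.X (i + 1)) z) =
      tensorProj k n M (Q.X i) (Q.restrictS.tensorD M i z) :=
  lTensor_tensorProj (Q.d i) z

/-- The long exact sequence, computed with a single resolution over `R`. -/
theorem exists_exact_torMulX0_restrictS (hM : IsGradedModule (gradingR k n) ℳ) :
    ∃ (f : ∀ (i : ℕ) (t : ℤ), Q.restrictS.Tor ℳ i t →ₗ[k] Q.Tor ℳ i t)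
      (g : ∀ (i : ℕ) (t : ℤ), Q.Tor ℳ (i + 1) (t + 1) →ₗ[k] Q.restrictS.Tor ℳ i t),
      (∀ i t, Function.Exact (f (i + 1) (t + 1)) (g i t)) ∧
      (∀ i t, Function.Exact (g i t) (torMulX0 Q.restrictS hM i t)) ∧
      (∀ i t, Function.Exact (torMulX0 Q.restrictS hM i t) (f i (t + 1))) ∧
      (∀ t, Function.Surjective (f 0 t)) := by
  let P := Q.restrictS
  let D (i : ℕ) : M ⊗[PolyS k n] P.X i →ₗ[k] M ⊗[PolyS k n] P.X i :=
    X0Commutator k n M (Q.X i)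
  let π (i : ℕ) : M ⊗[PolyS k n] P.X i →ₗ[k] M ⊗[PolyR k n] Q.X i := tensorProj k n M (Q.X i)
  have hD (t : ℤ) (i : ℕ) (z) (hz : z ∈ tensorDegree (PolyS k n) ℳ (P.gr i) t) :
      D i z ∈ tensorDegree (PolyS k n) ℳ (P.gr i) (t + 1) :=
    X0Commutator_mem_tensorDegree hM (Q.graded i) hz
  have hmap (t : ℤ) (i : ℕ) :=
    map_tensorProj_tensorDegree (k := k) (n := n) (ℳ := ℳ) (𝒩 := Q.gr i) t
  have hπ (t : ℤ) (i : ℕ) (z) (hz : z ∈ tensorDegree (PolyS k n) ℳ (P.gr i) t) :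
      π i z ∈ tensorDegree (PolyR k n) ℳ (Q.gr i) t := by
    rw [← hmap]
    exact ⟨z, hz, rfl⟩
  have hDd := Q.tensorD_X0Commutator (M := M)
  have hπd := Q.tensorD_tensorProj (M := M)
  obtain ⟨g, h₁, h₂, h₃, h₄⟩ := exists_exact_tor (P := P) (Q := Q) D π hD hπ hDd hπd
    (fun i => by
      obtain ⟨ι, c, -⟩ := Q.free i
      exact X0Commutator_injective (N := Q.X i) c)
    (fun i z => tensorProj_X0Commutator (N := Q.X i) z)
    (fun t i z hz h =>
      exists_mem_tensorDegree_X0Commutator_eq (N := Q.X i) hM (Q.graded i) (Q.free i) hz h)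
    (fun t i c hc => by
      rw [← hmap] at hc
      exact hc)
  -- The two chain maps differ by `1 ⊗ x₀`, which sends cycles to boundaries.
  have hmul (i : ℕ) (t : ℤ) : torMulX0 P hM i t = torChainMap D (hD t) hDd i := by
    refine LinearMap.ext fun ξ => ?_
    obtain ⟨z, hz, rfl⟩ := exists_torMk ξ
    refine torMk_eq_torMk.2 ?_
    change (mulX0 k n M).rTensor (Q.X i) z -
      ((mulX0 k n M).rTensor (Q.X i) z - (mulX0 k n (Q.X i)).lTensor M z) ∈ _
    rw [sub_sub_cancel]
    exact Q.lTensor_mulX0_mem_boundaries hz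
  refine ⟨fun i t => torChainMap π (hπ t) hπd i, g, h₁, fun i t => ?_, fun i t => ?_, h₄⟩
  · rw [hmul]
    exact h₂ i t
  · rw [hmul]
    exact h₃ i t

end GradedFreeResolution

end PolynomialRings

/-! ### Passage to an arbitrary resolution over `S₁`. -/

/-- Transport of a long exact sequence along isomorphisms. -/
theorem exists_exact_of_linearEquiv {k : Type*} [Field k] {T T' U : ℕ → ℤ → Type*}
    [∀ i t, AddCommGroup (T i t)] [∀ i t, Module k (T i t)] [∀ i t, AddCommGroup (T' i t)]
    [∀ i t, Module k (T' i t)] [∀ i t, AddCommGroup (U i t)] [∀ i t, Module k (U i t)]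
    (θ : ∀ i t, T i t ≃ₗ[k] T' i t) (m : ∀ i t, T i t →ₗ[k] T i (t + 1))
    (m' : ∀ i t, T' i t →ₗ[k] T' i (t + 1))
    (hm : ∀ i t ξ, θ i (t + 1) (m i t ξ) = m' i t (θ i t ξ))
    (f : ∀ i t, T' i t →ₗ[k] U i t) (g : ∀ i t, U (i + 1) (t + 1) →ₗ[k] T' i t)
    (h₁ : ∀ i t, Function.Exact (f (i + 1) (t + 1)) (g i t))
    (h₂ : ∀ i t, Function.Exact (g i t) (m' i t))
    (h₃ : ∀ i t, Function.Exact (m' i t) (f i (t + 1)))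
    (h₄ : ∀ t, Function.Surjective (f 0 t)) :
    ∃ (f : ∀ i t, T i t →ₗ[k] U i t) (g : ∀ i t, U (i + 1) (t + 1) →ₗ[k] T i t),
      (∀ i t, Function.Exact (f (i + 1) (t + 1)) (g i t)) ∧
      (∀ i t, Function.Exact (g i t) (m i t)) ∧
      (∀ i t, Function.Exact (m i t) (f i (t + 1))) ∧
      (∀ t, Function.Surjective (f 0 t)) := by
  refine ⟨fun i t => (f i t).comp (θ i t).toLinearMap,
    fun i t => (θ i t).symm.toLinearMap.comp (g i t), fun i t ξ => ?_, fun i t ξ => ?_,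
    fun i t ξ => ?_, fun t => (h₄ t).comp (θ 0 t).surjective⟩
  · rw [LinearMap.comp_apply, LinearEquiv.coe_coe, LinearEquiv.map_eq_zero_iff, h₁ i t ξ]
    exact ((θ (i + 1) (t + 1)).surjective.range_comp (f (i + 1) (t + 1)) ▸ Iff.rfl)
  · rw [← LinearEquiv.map_eq_zero_iff (θ i (t + 1)), hm, h₂ i t]
    constructor
    · rintro ⟨η, h⟩
      exact ⟨η, (LinearEquiv.symm_apply_eq _).2 h⟩
    · rintro ⟨η, rfl⟩
      exact ⟨η, ((θ i t).apply_symm_apply _).symm⟩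
  · rw [LinearMap.comp_apply, LinearEquiv.coe_coe, h₃ i t]
    constructor
    · rintro ⟨η, h⟩
      refine ⟨(θ i t).symm η, (θ i (t + 1)).injective ?_⟩
      rw [hm, LinearEquiv.apply_symm_apply, h]
    · rintro ⟨η, rfl⟩
      exact ⟨θ i t η, (hm i t η).symm⟩

theorem theorem2p2 {k : Type u} [Field k] (n : ℕ)
    {M : Type v} [AddCommGroup M] [Module k M] [Module (PolyR k n) M]
    [IsScalarTower k (PolyR k n) M]
    (ℳ : ℤ → Submodule k M) (hM : IsGradedModule (gradingR k n) ℳ)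
    (P : GradedFreeResolution.{u, u, w} (gradingS k n) (augS k n))
    (Q : GradedFreeResolution.{u, u, w} (gradingR k n) (augR k n)) :
    ∃ (f : ∀ (i : ℕ) (t : ℤ), P.Tor ℳ i t →ₗ[k] Q.Tor ℳ i t)
      (g : ∀ (i : ℕ) (t : ℤ), Q.Tor ℳ (i + 1) (t + 1) →ₗ[k] P.Tor ℳ i t),
      (∀ i t, Function.Exact (f (i + 1) (t + 1)) (g i t)) ∧
      (∀ i t, Function.Exact (g i t) (torMulX0 P hM i t)) ∧
      (∀ i t, Function.Exact (torMulX0 P hM i t) (f i (t + 1))) ∧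
      (∀ t, Function.Surjective (f 0 t)) := by
  obtain ⟨f, g, h₁, h₂, h₃, h₄⟩ := Q.exists_exact_torMulX0_restrictS hM
  -- Only the `S₁` side needs changing, since `Q` already computes `Tor` over `R`; naturality of `θ`
  -- in `M` keeps the middle map equal to multiplication by `x₀`.
  obtain ⟨θ, hθ⟩ := GradedFreeResolution.exists_torEquiv (A := PolyS k n) (𝒜 := gradingS k n)
    iSup_gradingS P Q.restrictS ℳ
  exact exists_exact_of_linearEquiv (T := P.Tor ℳ) (T' := Q.restrictS.Tor ℳ) (U := Q.Tor ℳ) θ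
    (torMulX0 P hM) (torMulX0 Q.restrictS hM)
    (hθ (mulX0 k n M) 1 (mulX0_mem hM)) f g h₁ h₂ h₃ h₄
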